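/- Let $n,m,N\ge 0$ be integers, $n_z=n+m$, and write $z=(x,u)\in\mathbb R^{n_z}$. Consider the system $\dot x=h(x,u)=f(x,u)+g(x,u)$, where $f:\mathbb R^{n_z}\to\mathbb R^n$ is a known continuously differentiable function and $g=(g_1,\dots,g_n):\mathbb R^{n_z}\to\mathbb R^n$ is a random function on a probability space with (almost surely) continuously differentiable sample paths, whose components $g_1,\dots,g_n$ are independent zero-mean Gaussian processes with squared-exponential covariance kernels $$k_i(z,z')=\sigma_{\eta,i}^2\exp\!\Big(-\tfrac12 (z-z')^{\mathsf T}L_i^{-2}(z-z')\Big),\qquad \sigma_{\eta,i}^2>0,\quad L_i=\mathrm{Diag}(l_i),\quad l_i\in(0,\infty)^{n_z}.$$ Let $z^{(1)},\dots,z^{(N)}\in\mathbb R^{n_z}$ be given inputs and let $\mathcal D$ consist of the observations $y^{(a)}=\dot x^{(a)}-f(z^{(a)})+w^{(a)}$ with $\dot x^{(a)}=h(z^{(a)})$, $a=1,\dots,N$, where the noise vectors $w^{(a)}\sim\mathcal N(0,\Sigma_{\mathrm n})$ are i.i.d. and independent of $g$, with $\Sigma_{\mathrm n}$ an $n\times n$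 positive semidefinite covariance matrix. For $i=1,\dots,n$ put $y_i=(y_i^{(1)},\dots,y_i^{(N)})^{\mathsf T}$ and $\bar K_i=\big(k_i(z^{(a)},z^{(b)})\big)_{a,b}+(\Sigma_{\mathrm n})_{ii}I_N$, and assume that the matrices $\bar K_i$ are invertible (which is automatic if $(\Sigma_{\mathrm n})_{ii}>0$ for all $i$). For a fixed point $z_{\mathrm e}\in\mathbb R^{n_z}$ let $D_i\in\mathbb R^{n_z\times N}$ have the entries $(D_i)_{ja}=\partial_{z_j}k_i(z^{(a)},z)|_{z=z_{\mathrm e}}$, let $H_i\in\mathbb R^{n_z\times n_z}$ have the entries $(H_i)_{jj'}=\partial_{z_j}\partial_{z'_{j'}}k_i(z,z')|_{z=z'=z_{\mathrm e}}$, and let $$\mu_i'=D_i\bar K_i^{-1}y_i,\qquad \Sigma_i'=H_i-D_i\bar K_i^{-1}D_i^{\mathsf T}$$ be the Gaussian-process posterior mean and covariance of the gradient of $g_i$ at $z_{\mathrm e}$. For $p\in[0,1)$ let $\chi^2_{n_z}$ be the quantile function of the chi-squared distribution with $n_z$ degrees of freedom, and let $\hat C,\bar C\in\mathbb R^{n\times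 n_z}$ have the entries $$\hat C_{ij}=\frac{\partial f_i}{\partial z_j}(z_{\mathrm e})+(\mu_i')_j,\qquad \bar C_{ij}=\sqrt{\chi^2_{n_z}(p)}\,\sqrt{(\Sigma_i')_{jj}}.$$ Let $\mathcal C=[\hat C-\bar C,\hat C+\bar C]$ be the set of all real $n\times n_z$ matrices that lie entrywise between $\hat C-\bar C$ and $\hat C+\bar C$. Then $$\Pr\Big(\frac{\partial h}{\partial z}\Big|_{z_{\mathrm e}}\in\mathcal C\Big)\ge p^n .$$ If moreover $\Sigma_{\mathrm n}$ is diagonal, the same holds conditionally on the data: almost surely, $$\Pr\Big(\frac{\partial h}{\partial z}\Big|_{z_{\mathrm e}}\in\mathcal C\;\Big|\;\mathcal D\Big)\ge p^n .$$ -/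

import Mathlib

open MeasureTheory ProbabilityTheory Matrix

noncomputable section

namespace GPLin

/-- The space of state-input pairs `z = (x, u) ∈ ℝⁿ × ℝᵐ`, of dimension `n_z = n + m`. The first `n`
coordinates (`Sum.inl`) are the state, the last `m` (`Sum.inr`) the input. -/
abbrev StateInput (n m : ℕ) : Type := Fin n ⊕ Fin m → ℝ

/-- The partial derivative of `F` at `z` with respect to the coordinate `j`. -/
def partialDeriv {n m : ℕ} (F : StateInput n m → ℝ) (z : StateInput n m) (j : Fin n ⊕ Fin m) : ℝ :=
  fderiv ℝ F z (Pi.single j 1)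

/-- The Jacobian matrix `∂F/∂z` at `z`, of size `n × n_z`. -/
def jacobian {n m : ℕ} (F : StateInput n m → Fin n → ℝ) (z : StateInput n m) :
    Matrix (Fin n) (Fin n ⊕ Fin m) ℝ :=
  Matrix.of fun i j => partialDeriv (fun z' => F z' i) z j

/-- The squared-exponential kernel
`σ² exp (-(1/2) (z - z')ᵀ L⁻² (z - z'))` with output variance `σ²` and `L = Diag l`. -/
def seKernel {n m : ℕ} (σ : ℝ) (l : Fin n ⊕ Fin m → ℝ) (z z' : StateInput n m) : ℝ :=
  σ ^ 2 * Real.exp (-(1 / 2) * ∑ j, (z j - z' j) ^ 2 / l j ^ 2)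

/-- `X` is a Gaussian process under `P` with mean zero and covariance function `k`. -/
structure IsZeroMeanGP {Ω T : Type*} [MeasurableSpace Ω] (X : T → Ω → ℝ) (k : T → T → ℝ)
    (P : Measure Ω) : Prop where
  gaussian : IsGaussianProcess X P
  mean : ∀ t, ∫ ω, X t ω ∂P = 0
  cov : ∀ s t, covariance (X s) (X t) P = k s t

/-- The chi-squared distribution with `d` degrees of freedom: the law of the sum of the squares of
`d` independent standard normal variables. -/
def chiSquared (d : ℕ) : Measure ℝ :=
  (Measure.pi fun _ : Fin d => gaussianReal 0 1).map fun x => ∑ j, x j ^ 2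

/-- The quantile function of the chi-squared distribution (which lives on `[0, ∞)`):
the least `x ≥ 0` with `p ≤ Pr (χ² ≤ x)`. -/
def chiSquaredQuantile (d : ℕ) (p : ℝ) : ℝ :=
  sInf {x : ℝ | 0 ≤ x ∧ p ≤ cdf (chiSquared d) x}

section Posterior

variable {n m N : ℕ}

/-- The matrix `K̄ = K + s I` with `K a b = k (z a) (z b)`; `s` is the variance of the noise. -/
def noisyGram (k : StateInput n m → StateInput n m → ℝ) (s : ℝ) (z : Fin N → StateInput n m) :
    Matrix (Fin N) (Fin N) ℝ :=
  Matrix.of (fun a b => k (z a) (z b)) + s • (1 : Matrix (Fin N) (Fin N) ℝ)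

/-- The `n_z × N` matrix `∂k(z)/∂z` at `zs`, where `k(z)` is the vector of the `k (z a) z`. -/
def crossDeriv (k : StateInput n m → StateInput n m → ℝ) (z : Fin N → StateInput n m)
    (zs : StateInput n m) : Matrix (Fin n ⊕ Fin m) (Fin N) ℝ :=
  Matrix.of fun j a => partialDeriv (fun z' => k (z a) z') zs j

/-- The prior covariance of the gradient at `zs`: the mixed second derivatives of the kernel, one in
each argument, at `(zs, zs)`. -/
def kernelHess (k : StateInput n m → StateInput n m → ℝ) (zs : StateInput n m) :
    Matrix (Fin n ⊕ Fin m) (Fin n ⊕ Fin m) ℝ :=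
  Matrix.of fun j j' => partialDeriv (fun z₁ => partialDeriv (fun z₂ => k z₁ z₂) zs j') zs j

/-- The posterior mean `μ'` of the gradient at `zs` given the targets `y` at the inputs `z`. -/
def postDerivMean (k : StateInput n m → StateInput n m → ℝ) (s : ℝ) (z : Fin N → StateInput n m)
    (y : Fin N → ℝ) (zs : StateInput n m) : Fin n ⊕ Fin m → ℝ :=
  crossDeriv k z zs *ᵥ ((noisyGram k s z)⁻¹ *ᵥ y)

/-- The posterior covariance `Σ'` of the gradient at `zs`. -/
def postDerivCov (k : StateInput n m → StateInput n m → ℝ) (s : ℝ) (z : Fin N → StateInput n m)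
    (zs : StateInput n m) : Matrix (Fin n ⊕ Fin m) (Fin n ⊕ Fin m) ℝ :=
  kernelHess k zs - crossDeriv k z zs * (noisyGram k s z)⁻¹ * (crossDeriv k z zs)ᵀ

/-- `Ĉ`: the Jacobian of the known part plus the posterior means of the gradients of the unknown
components, as rows. Here `k i` and `s i` are the kernel and the noise variance of the component
`i`, and `y a i` is the component `i` of the target at the input `z a`. -/
def nominalJacobian (f : StateInput n m → Fin n → ℝ)
    (k : Fin n → StateInput n m → StateInput n m → ℝ) (s : Fin n → ℝ)
    (z : Fin N → StateInput n m) (y : Fin N → Fin n → ℝ) (zs : StateInput n m) :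
    Matrix (Fin n) (Fin n ⊕ Fin m) ℝ :=
  jacobian f zs + Matrix.of fun i => postDerivMean (k i) (s i) z (fun a => y a i) zs

/-- `C̄`: the square root of the chi-squared quantile of degree `n_z`, times the square roots of the
diagonals of the posterior covariances of the gradients, as rows. -/
def jacobianRadius (k : Fin n → StateInput n m → StateInput n m → ℝ) (s : Fin n → ℝ)
    (z : Fin N → StateInput n m) (zs : StateInput n m) (p : ℝ) :
    Matrix (Fin n) (Fin n ⊕ Fin m) ℝ :=
  √(chiSquaredQuantile (n + m) p) •
    Matrix.of fun i j => √(postDerivCov (k i) (s i) z zs j j)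

end Posterior

/-- The interval matrix `[A, B]`: all matrices that lie entrywise between `A` and `B`. -/
def matrixBox {ι κ : Type*} (A B : Matrix ι κ ℝ) : Set (Matrix ι κ ℝ) :=
  {M | ∀ i j, A i j ≤ M i j ∧ M i j ≤ B i j}

/-- The right-hand side `h = f + g` of the dynamics `ẋ = h (x, u)`, for the realization `g ω` of the
unknown part. -/
def dynamics {Ω : Type*} {n m : ℕ} (f : StateInput n m → Fin n → ℝ)
    (g : Ω → StateInput n m → Fin n → ℝ) (ω : Ω) : StateInput n m → Fin n → ℝ :=
  fun z => f z + g ω z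

/-- The targets `y a = ẋ a - f (z a) + w a` with `ẋ a = h (z a)`, for the noise `w`. -/
def targets {Ω : Type*} {n m N : ℕ} (f : StateInput n m → Fin n → ℝ)
    (g : Ω → StateInput n m → Fin n → ℝ) (w : Fin N → Ω → EuclideanSpace ℝ (Fin n))
    (z : Fin N → StateInput n m) (ω : Ω) : Fin N → Fin n → ℝ :=
  fun a i => dynamics f g ω (z a) i - f (z a) i + w a ω i

/-- The random set `𝒞 = [Ĉ - C̄, Ĉ + C̄]` computed from the targets `y`. -/
def uncertaintyBox {n m N : ℕ} (f : StateInput n m → Fin n → ℝ)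
    (k : Fin n → StateInput n m → StateInput n m → ℝ) (s : Fin n → ℝ)
    (z : Fin N → StateInput n m) (y : Fin N → Fin n → ℝ) (zs : StateInput n m) (p : ℝ) :
    Set (Matrix (Fin n) (Fin n ⊕ Fin m) ℝ) :=
  matrixBox (nominalJacobian f k s z y zs - jacobianRadius k s z zs p)
    (nominalJacobian f k s z y zs + jacobianRadius k s z zs p)

end GPLin

end

/-!
The matrix `∂h/∂z` lies in the box exactly when every entry `R i j` of the residual, the gradient
of `g i` at `ze` minus its posterior mean, satisfies `|R i j| ≤ √q √(Σ'_i j j)`, where `q` is the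
chi-squared quantile. The family `R` is centered Gaussian and `R i j` has variance `Σ'_i j j`, so
each of these events has probability at least that of `|Z| ≤ √q` for a standard normal `Z`. For a
general noise covariance the components of `R` are dependent across `i`, and Šidák's inequality
(`HasGaussianLaw.prod_measure_abs_le_le`) bounds the probability of the intersection of symmetric
slabs from below by the product of the probabilities of the slabs. This product is
`(Pr (|Z| ≤ √q) ^ n_z) ^ n`, and `Pr (|Z| ≤ √q) ^ n_z ≥ Pr (χ² ≤ q) ≥ p` because the ball of radius
`√q` is contained in the cube of half-width `√q` (`ofReal_le_gaussianReal_abs_le_pow`). If the noise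
covariance is diagonal, then `R` is uncorrelated with, hence independent of, all the data, and the
conditional probability equals the unconditional one.

Šidák's inequality is obtained by splitting off one coordinate `U` of a Gaussian vector `X`: the
rest `Y = X - U v` is independent of `U`, the function `u ↦ Pr (Y + u v ∈ K)` is nonincreasing in
`|u|` for symmetric convex `K` (Anderson, `HasGaussianLaw.measure_add_smul_mem_anti`), and `|U| ≤ c`
favours small `|u|`. The monotonicity is a consequence of the Prékopa–Leindler inequality for the
standard Gaussian measure (`prekopaLeindler_pi_gaussianReal`), which tensorizes from dimension one,
where it rests on the Brunn–Minkowski inequality on the line.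

The gradient of `g i` is not one of the variables of the Gaussian process, so the argument is applied
to difference quotients. Their residuals `diffResidual` are corrected by the exact best linear
predictor for the given step, which makes them exactly uncorrelated with the observations of the
component `i`; as the step tends to `0` they converge almost surely to `R`, and their variances
converge to `Σ'_i j j`. The passage to the limit, on an event `A` determined by the data, is
`le_measure_abs_le_inter_of_tendsto`.
-/

noncomputable section

open Set Filter Topology
open scoped ENNReal MatrixOrder

/-! ### The Prékopa–Leindler inequality for Gaussian measures -/

/-- The Brunn–Minkowski inequality on the line for compact sets: `A + B` contains the translates
`A + min B` and `max A + B`, which meet in one point. -/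
theorem volume_add_le_of_isCompact {A B C : Set ℝ} (hA : IsCompact A) (hB : IsCompact B)
    (hA' : A.Nonempty) (hB' : B.Nonempty) (hC : ∀ x ∈ A, ∀ y ∈ B, x + y ∈ C) :
    volume A + volume B ≤ volume C := by
  obtain ⟨M, hM, hMax⟩ := hA.exists_isGreatest hA'
  obtain ⟨m, hm, hMin⟩ := hB.exists_isLeast hB'
  have h1 : volume ((fun x => x + m) '' A) = volume A := by
    simp [image_add_right, measure_preimage_add_right]
  have h2 : volume ((fun y => M + y) '' B) = volume B := by
    simp [image_add_left, measure_preimage_add]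
  have hdisj : AEDisjoint volume ((fun x => x + m) '' A) ((fun y => M + y) '' B) := by
    refine measure_mono_null (t := {M + m}) ?_ (by simp)
    rintro _ ⟨⟨x, hx, rfl⟩, y, hy, hxy⟩
    have := hMax hx
    have := hMin hy
    simp only [mem_singleton_iff] at *
    linarith
  rw [← h1, ← h2, ← measure_union₀ (hB.image (by fun_prop)).measurableSet.nullMeasurableSet hdisj]
  refine measure_mono ?_
  rintro _ (⟨x, hx, rfl⟩ | ⟨y, hy, rfl⟩)
  · exact hC x hx m hm
  · exact hC M hM y hy

theorem volume_add_le {A B C : Set ℝ} (hA : MeasurableSet A) (hB : MeasurableSet B)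
    (hA' : A.Nonempty) (hB' : B.Nonempty) (hC : ∀ x ∈ A, ∀ y ∈ B, x + y ∈ C) :
    volume A + volume B ≤ volume C := by
  obtain ⟨a, ha⟩ := hA'
  obtain ⟨b, hb⟩ := hB'
  rw [hA.measure_eq_iSup_isCompact, hB.measure_eq_iSup_isCompact]
  simp only [iSup_and']
  refine ENNReal.biSup_add_biSup_le' ⟨∅, by simp⟩ ⟨∅, by simp⟩ fun K hK L hL => ?_
  -- Adjoining the points `a` and `b` makes the compact sets nonempty.
  refine (add_le_add (measure_mono (subset_insert a K)) (measure_mono (subset_insert b L))).trans ?_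
  refine volume_add_le_of_isCompact (hK.2.insert a) (hL.2.insert b) (insert_nonempty _ _)
    (insert_nonempty _ _) fun x hx y hy => hC x ?_ y ?_
  · exact insert_subset ha hK.1 hx
  · exact insert_subset hb hL.1 hy

theorem volume_convexComb_le {A B C : Set ℝ} {a b : ℝ} (ha : 0 < a) (hb : 0 < b)
    (hA : MeasurableSet A) (hB : MeasurableSet B) (hA' : A.Nonempty) (hB' : B.Nonempty)
    (hC : ∀ x ∈ A, ∀ y ∈ B, a * x + b * y ∈ C) :
    ENNReal.ofReal a * volume A + ENNReal.ofReal b * volume B ≤ volume C := by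
  have hs (r : ℝ) (hr : 0 < r) (s : Set ℝ) :
      ENNReal.ofReal r * volume s = volume ((fun x => r * x) '' s) := by
    have := Measure.addHaar_smul volume r s
    simp only [Module.finrank_self, pow_one, abs_of_pos hr] at this
    rw [← this]; rfl
  have hm (r : ℝ) (hr : 0 < r) (s : Set ℝ) (h : MeasurableSet s) :
      MeasurableSet ((fun x => r * x) '' s) :=
    (MeasurableEquiv.mulLeft₀ r hr.ne').measurableEmbedding.measurableSet_image.2 h
  rw [hs a ha, hs b hb]
  refine volume_add_le (hm a ha A hA) (hm b hb B hB) (hA'.image _) (hB'.image _) ?_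
  rintro _ ⟨x, hx, rfl⟩ _ ⟨y, hy, rfl⟩
  exact hC x hx y hy

/-- The layer cake formula for functions with values in `[0, 1]`. -/
theorem lintegral_eq_lintegral_lt_toReal {α : Type*} [MeasurableSpace α] (μ : Measure α)
    {f : α → ℝ≥0∞} (hf : Measurable f) (hf1 : ∀ x, f x ≤ 1) :
    ∫⁻ x, f x ∂μ = ∫⁻ t in Ioo (0 : ℝ) 1, μ {x | ENNReal.ofReal t < f x} := by
  have hfin (x) : f x ≠ ⊤ := ne_top_of_le_ne_top ENNReal.one_ne_top (hf1 x)
  have h1 : ∫⁻ x, f x ∂μ = ∫⁻ x, ENNReal.ofReal (f x).toReal ∂μ := by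
    simp [ENNReal.ofReal_toReal, hfin]
  rw [h1, lintegral_eq_lintegral_meas_lt μ (.of_forall fun x => ENNReal.toReal_nonneg)
    hf.ennreal_toReal.aemeasurable,
    ← lintegral_inter_add_sdiff (μ := volume) _ (Ioi (0 : ℝ)) (measurableSet_Iio (a := (1 : ℝ)))]
  have h2 : ∫⁻ t in Ioi (0 : ℝ) \ Iio 1, μ {x | t < (f x).toReal} = 0 := by
    refine setLIntegral_eq_zero (measurableSet_Ioi.diff measurableSet_Iio) ?_
    intro t ht
    have : {x | t < (f x).toReal} = ∅ := by
      ext x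
      have := ENNReal.toReal_mono ENNReal.one_ne_top (hf1 x)
      have h3 : 1 ≤ t := not_lt.1 ht.2
      simp only [ENNReal.toReal_one] at this
      simp; linarith
    simp [this]
  rw [h2, add_zero, Ioi_inter_Iio]
  refine setLIntegral_congr_fun measurableSet_Ioo fun t ht => ?_
  congr 1; ext x
  exact (ENNReal.ofReal_lt_iff_lt_toReal ht.1.le (hfin x)).symm

theorem ENNReal.geom_mean_le_arith_mean {a b : ℝ} (ha : 0 < a) (hb : 0 < b) (hab : a + b = 1)
    (x y : ℝ≥0∞) : x ^ a * y ^ b ≤ ENNReal.ofReal a * x + ENNReal.ofReal b * y := by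
  have ha' := ENNReal.ofReal_pos.2 ha
  have hb' := ENNReal.ofReal_pos.2 hb
  rcases eq_or_ne x ⊤ with rfl | hx
  · simp [ENNReal.mul_top ha'.ne']
  rcases eq_or_ne y ⊤ with rfl | hy
  · simp [ENNReal.mul_top hb'.ne']
  lift x to NNReal using hx
  lift y to NNReal using hy
  have h := NNReal.geom_mean_le_arith_mean2_weighted a.toNNReal b.toNNReal x y
    (by rw [← Real.toNNReal_add ha.le hb.le, hab, Real.toNNReal_one])
  rw [Real.coe_toNNReal a ha.le, Real.coe_toNNReal b hb.le] at h
  rw [← ENNReal.coe_rpow_of_nonneg _ ha.le, ← ENNReal.coe_rpow_of_nonneg _ hb.le]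
  simp only [ENNReal.ofReal]
  exact_mod_cast h

/-- The additive form of the Prékopa–Leindler inequality for functions of supremum one: the
superlevel sets of `f` and `g` at every level in `(0, 1)` are nonempty, so the Brunn–Minkowski
inequality applies to them. -/
theorem lintegral_convexComb_le_of_iSup_eq_one {a b : ℝ} (ha : 0 < a) (hb : 0 < b)
    (hab : a + b = 1) {f g h : ℝ → ℝ≥0∞} (hf : Measurable f) (hg : Measurable g)
    (hh : Measurable h) (hf1 : ⨆ x, f x = 1) (hg1 : ⨆ x, g x = 1)
    (H : ∀ x y, f x ^ a * g y ^ b ≤ h (a * x + b * y)) :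
    ENNReal.ofReal a * (∫⁻ x, f x) + ENNReal.ofReal b * (∫⁻ x, g x) ≤ ∫⁻ x, h x := by
  refine le_trans ?_ (lintegral_mono fun x => min_le_left (h x) 1)
  rw [lintegral_eq_lintegral_lt_toReal volume hf fun x => hf1 ▸ le_iSup f x,
    lintegral_eq_lintegral_lt_toReal volume hg fun x => hg1 ▸ le_iSup g x,
    lintegral_eq_lintegral_lt_toReal volume (hh.min measurable_const) fun x => min_le_right _ _]
  have hmeas (f : ℝ → ℝ≥0∞) : Measurable fun t => volume {x | ENNReal.ofReal t < f x} :=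
    Antitone.measurable fun s t hst => measure_mono fun x hx =>
      (ENNReal.ofReal_le_ofReal hst).trans_lt hx
  rw [← lintegral_const_mul _ (hmeas f), ← lintegral_const_mul _ (hmeas g),
    ← lintegral_add_left ((hmeas f).const_mul _)]
  refine setLIntegral_mono' measurableSet_Ioo fun t ht => ?_
  have ht1 : ENNReal.ofReal t < 1 := by simpa using ht.2
  have ht0 : 0 < ENNReal.ofReal t := ENNReal.ofReal_pos.2 ht.1
  have hft : ∃ x, ENNReal.ofReal t < f x := lt_iSup_iff.1 (hf1 ▸ ht1)
  have hgt : ∃ x, ENNReal.ofReal t < g x := lt_iSup_iff.1 (hg1 ▸ ht1)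
  refine volume_convexComb_le ha hb (measurableSet_lt measurable_const hf)
    (measurableSet_lt measurable_const hg) hft hgt
    fun x hx y hy => lt_min ?_ ht1
  refine lt_of_lt_of_le ?_ (H x y)
  calc ENNReal.ofReal t = ENNReal.ofReal t ^ a * ENNReal.ofReal t ^ b := by
        rw [← ENNReal.rpow_add _ _ ht0.ne' ENNReal.ofReal_ne_top, hab, ENNReal.rpow_one]
    _ < f x ^ a * g y ^ b := ENNReal.mul_lt_mul (ENNReal.rpow_lt_rpow hx ha)
        (ENNReal.rpow_lt_rpow hy hb)

/-- The Prékopa–Leindler inequality on the line for bounded functions. Dividing `f` and `g` by their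
suprema reduces it to `lintegral_convexComb_le_of_iSup_eq_one` and the inequality of the means. -/
theorem prekopaLeindler_real {a b : ℝ} (ha : 0 < a) (hb : 0 < b)
    (hab : a + b = 1) {f g h : ℝ → ℝ≥0∞} (hf : Measurable f) (hg : Measurable g)
    (hh : Measurable h) {M : ℝ≥0∞} (hM : M ≠ ⊤) (hf1 : ∀ x, f x ≤ M) (hg1 : ∀ x, g x ≤ M)
    (H : ∀ x y, f x ^ a * g y ^ b ≤ h (a * x + b * y)) :
    (∫⁻ x, f x) ^ a * (∫⁻ x, g x) ^ b ≤ ∫⁻ x, h x := by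
  set S := ⨆ x, f x with hS
  set T := ⨆ x, g x with hT
  have hStop : S ≠ ⊤ := ne_top_of_le_ne_top hM (iSup_le hf1)
  have hTtop : T ≠ ⊤ := ne_top_of_le_ne_top hM (iSup_le hg1)
  rcases eq_or_ne S 0 with hS0 | hS0
  · have : ∀ x, f x = 0 := by simpa [hS] using hS0
    simp [this, ha]
  rcases eq_or_ne T 0 with hT0 | hT0
  · have : ∀ x, g x = 0 := by simpa [hT] using hT0
    simp [this, hb]
  have key := lintegral_convexComb_le_of_iSup_eq_one ha hb hab (hf.const_mul S⁻¹)
    (hg.const_mul T⁻¹) (hh.const_mul ((S⁻¹) ^ a * (T⁻¹) ^ b))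
    (by rw [← ENNReal.mul_iSup, ← hS, ENNReal.inv_mul_cancel hS0 hStop])
    (by rw [← ENNReal.mul_iSup, ← hT, ENNReal.inv_mul_cancel hT0 hTtop]) (fun x y => by
      rw [ENNReal.mul_rpow_of_nonneg _ _ ha.le, ENNReal.mul_rpow_of_nonneg _ _ hb.le,
        mul_mul_mul_comm]
      gcongr
      exact H x y)
  rw [lintegral_const_mul _ hf, lintegral_const_mul _ hg, lintegral_const_mul _ hh] at key
  have key2 := (ENNReal.geom_mean_le_arith_mean ha hb hab _ _).trans key
  rw [ENNReal.mul_rpow_of_nonneg _ _ ha.le, ENNReal.mul_rpow_of_nonneg _ _ hb.le,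
    mul_mul_mul_comm] at key2
  clear_value S T
  refine (ENNReal.mul_le_mul_iff_right ?_ ?_).1 key2
  · exact mul_ne_zero (ENNReal.rpow_pos (by simpa using hStop) (by simpa using hS0)).ne'
      (ENNReal.rpow_pos (by simpa using hTtop) (by simpa using hT0)).ne'
  · exact ENNReal.mul_ne_top (ENNReal.rpow_ne_top_of_nonneg ha.le (by simpa using hS0))
      (ENNReal.rpow_ne_top_of_nonneg hb.le (by simpa using hT0))

theorem gaussianPDF_logConcave {a b : ℝ} (ha : 0 < a) (hb : 0 < b) (hab : a + b = 1) (x y : ℝ) :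
    gaussianPDF 0 1 x ^ a * gaussianPDF 0 1 y ^ b ≤ gaussianPDF 0 1 (a * x + b * y) := by
  have hp (z : ℝ) := gaussianPDFReal_pos 0 1 z one_ne_zero
  simp only [gaussianPDF]
  rw [ENNReal.ofReal_rpow_of_pos (hp x), ENNReal.ofReal_rpow_of_pos (hp y),
    ← ENNReal.ofReal_mul (by have := hp x; positivity)]
  refine ENNReal.ofReal_le_ofReal ?_
  simp only [gaussianPDFReal]
  set C := (√(2 * Real.pi * (1 : NNReal)))⁻¹ with hC
  have hC0 : 0 < C := by rw [hC]; simp [Real.pi_pos]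
  rw [Real.mul_rpow hC0.le (Real.exp_pos _).le, Real.mul_rpow hC0.le (Real.exp_pos _).le,
    mul_mul_mul_comm, ← Real.rpow_add hC0, hab, Real.rpow_one, ← Real.exp_mul, ← Real.exp_mul,
    ← Real.exp_add]
  refine mul_le_mul_of_nonneg_left (Real.exp_le_exp.2 ?_) hC0.le
  obtain rfl : b = 1 - a := by linarith
  simp only [sub_zero, NNReal.coe_one, mul_one]
  nlinarith [mul_nonneg (mul_pos ha hb).le (sq_nonneg (x - y))]

theorem gaussianPDF_le (x : ℝ) :
    gaussianPDF 0 1 x ≤ ENNReal.ofReal (√(2 * Real.pi * (1 : NNReal)))⁻¹ := by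
  refine ENNReal.ofReal_le_ofReal (mul_le_of_le_one_right (by positivity) ?_)
  refine Real.exp_le_one_iff.2 (div_nonpos_of_nonpos_of_nonneg ?_ (by simp))
  simp [sq_nonneg]

/-- The Prékopa–Leindler inequality for the standard normal law, by log-concavity of its density. -/
theorem prekopaLeindler_gaussianReal {a b : ℝ} (ha : 0 < a) (hb : 0 < b)
    (hab : a + b = 1) {f g h : ℝ → ℝ≥0∞} (hf : Measurable f) (hg : Measurable g)
    (hh : Measurable h) (hf1 : ∀ x, f x ≤ 1) (hg1 : ∀ x, g x ≤ 1)
    (H : ∀ x y, f x ^ a * g y ^ b ≤ h (a * x + b * y)) :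
    (∫⁻ x, f x ∂gaussianReal 0 1) ^ a * (∫⁻ x, g x ∂gaussianReal 0 1) ^ b ≤
      ∫⁻ x, h x ∂gaussianReal 0 1 := by
  have hd {f : ℝ → ℝ≥0∞} (hf : Measurable f) :
      ∫⁻ x, f x ∂gaussianReal 0 1 = ∫⁻ x, gaussianPDF 0 1 x * f x := by
    rw [gaussianReal_of_var_ne_zero 0 one_ne_zero,
      lintegral_withDensity_eq_lintegral_mul _ (measurable_gaussianPDF 0 1) hf]
    rfl
  rw [hd hf, hd hg, hd hh]
  have hm := measurable_gaussianPDF 0 1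
  refine prekopaLeindler_real ha hb hab (hm.mul hf) (hm.mul hg) (hm.mul hh) ENNReal.ofReal_ne_top
    (fun x => (mul_le_of_le_one_right' (hf1 x)).trans (gaussianPDF_le x))
    (fun x => (mul_le_of_le_one_right' (hg1 x)).trans (gaussianPDF_le x)) fun x y => ?_
  rw [ENNReal.mul_rpow_of_nonneg _ _ ha.le, ENNReal.mul_rpow_of_nonneg _ _ hb.le,
    mul_mul_mul_comm]
  exact mul_le_mul' (gaussianPDF_logConcave ha hb hab x y) (H x y)

/-- The Prékopa–Leindler inequality for the standard Gaussian measure on `ℝᵈ`. The marginals in one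
coordinate satisfy the hypotheses of the one-dimensional inequality by induction. -/
theorem prekopaLeindler_pi_gaussianReal {a b : ℝ} (ha : 0 < a) (hb : 0 < b)
    (hab : a + b = 1) (d : ℕ) {f g h : (Fin d → ℝ) → ℝ≥0∞} (hf : Measurable f) (hg : Measurable g)
    (hh : Measurable h) (hf1 : ∀ x, f x ≤ 1) (hg1 : ∀ x, g x ≤ 1)
    (H : ∀ x y, f x ^ a * g y ^ b ≤ h (a • x + b • y)) :
    (∫⁻ x, f x ∂Measure.pi fun _ => gaussianReal 0 1) ^ a *
      (∫⁻ x, g x ∂Measure.pi fun _ => gaussianReal 0 1) ^ b ≤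
      ∫⁻ x, h x ∂Measure.pi fun _ => gaussianReal 0 1 := by
  induction d with
  | zero =>
    simp only [Measure.pi_of_empty _ (0 : Fin 0 → ℝ), lintegral_dirac]
    simpa using H 0 0
  | succ d ih =>
    have e := (measurePreserving_piFinSuccAbove (fun _ : Fin (d + 1) => gaussianReal 0 1) 0).symm
    have hI {f : (Fin (d + 1) → ℝ) → ℝ≥0∞} (hf : Measurable f) :
        ∫⁻ x, f x ∂Measure.pi (fun _ => gaussianReal 0 1) =
          ∫⁻ t, ∫⁻ x, f (Fin.cons t x) ∂Measure.pi (fun _ => gaussianReal 0 1)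
            ∂gaussianReal 0 1 := by
      rw [← e.lintegral_comp hf, lintegral_prod _ (by fun_prop)]
      simp [MeasurableEquiv.piFinSuccAbove, Fin.insertNthEquiv]
    have hc : Measurable fun p : ℝ × (Fin d → ℝ) => (Fin.cons p.1 p.2 : Fin (d + 1) → ℝ) := by
      refine measurable_pi_iff.2 fun i => ?_
      refine Fin.cases ?_ (fun i => ?_) i <;> simp <;> fun_prop
    have hc' (t : ℝ) : Measurable fun x : Fin d → ℝ => (Fin.cons t x : Fin (d + 1) → ℝ) :=
      hc.comp measurable_prodMk_left
    rw [hI hf, hI hg, hI hh]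
    have h1 {f : (Fin (d + 1) → ℝ) → ℝ≥0∞} (hf1 : ∀ x, f x ≤ 1) (t : ℝ) :
        ∫⁻ x : Fin d → ℝ, f (Fin.cons t x) ∂Measure.pi (fun _ => gaussianReal 0 1) ≤ 1 :=
      (lintegral_mono fun x => hf1 _).trans (by simp)
    refine prekopaLeindler_gaussianReal ha hb hab (hf.comp hc).lintegral_prod_right'
      (hg.comp hc).lintegral_prod_right' (hh.comp hc).lintegral_prod_right' (h1 hf1) (h1 hg1)
      fun s t => ?_
    refine ih (hf.comp (hc' s)) (hg.comp (hc' t)) (hh.comp (hc' _)) (fun x => hf1 _)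
      (fun x => hg1 _) fun x y => ?_
    refine (H _ _).trans_eq (congrArg h ?_)
    ext i
    refine Fin.cases ?_ (fun i => ?_) i <;> simp

/-! ### Anderson's and Šidák's inequalities -/

section

variable {Ω : Type*} [MeasurableSpace Ω] {P : Measure Ω} {ι : Type*} [Finite ι]

/-- The law of a centered Gaussian vector is a linear image of a standard Gaussian measure. -/
theorem ProbabilityTheory.HasGaussianLaw.exists_map_eq_map_pi {X : ι → Ω → ℝ}
    (hX : HasGaussianLaw (fun ω i => X i ω) P) (h0 : ∀ i, ∫ ω, X i ω ∂P = 0) :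
    ∃ (d : ℕ) (B : (Fin d → ℝ) →L[ℝ] (ι → ℝ)),
      P.map (fun ω i => X i ω) = (Measure.pi fun _ => gaussianReal 0 1).map B := by
  classical
  have := Fintype.ofFinite ι
  have := hX.isProbabilityMeasure
  have hXi (i) : HasGaussianLaw (X i) P := hX.eval i
  have hXL : HasGaussianLaw (fun ω => WithLp.toLp 2 fun i => X i ω) P := hX.toLp_pi 2
  set S : Matrix ι ι ℝ := Matrix.of fun i j => cov[X i, X j; P] with hS
  have := hXL.isGaussian_map
  have hcov (x y : EuclideanSpace ℝ ι) :
      covarianceBilin (P.map fun ω => WithLp.toLp 2 fun i => X i ω) x y = x ⬝ᵥ S *ᵥ y := by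
    rw [covarianceBilin_apply_pi fun i => (hXi i).memLp_two]
    simp only [dotProduct, mulVec, Finset.mul_sum, hS, of_apply]
    refine Finset.sum_congr rfl fun i _ => Finset.sum_congr rfl fun j _ => by ring
  have hSpos : S.PosSemidef := by
    refine Matrix.PosSemidef.of_dotProduct_mulVec_nonneg ?_ fun x => ?_
    · ext i j; simp [hS, covariance_comm]
    · have := hcov (WithLp.toLp 2 x) (WithLp.toLp 2 x)
      simp only [star_trivial]
      rw [← this]
      exact covarianceBilin_self_nonneg _
  have hlaw : P.map (fun ω => WithLp.toLp 2 fun i => X i ω) = multivariateGaussian 0 S := by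
    refine IsGaussian.ext ?_ ?_
    · rw [integral_id_multivariateGaussian', integral_map hXL.aemeasurable (by fun_prop)]
      ext i
      have := (EuclideanSpace.proj i : EuclideanSpace ℝ ι →L[ℝ] ℝ).integral_comp_comm
        hXL.integrable
      simpa [h0] using this.symm
    · ext x y
      rw [hcov, covarianceBilin_multivariateGaussian hSpos]
  have hX' : P.map (fun ω i => X i ω) =
      (P.map fun ω => WithLp.toLp 2 fun i => X i ω).map (EuclideanSpace.equiv ι ℝ) := by
    rw [AEMeasurable.map_map_of_aemeasurable (by fun_prop) hXL.aemeasurable]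
    rfl
  let b := stdOrthonormalBasis ℝ (EuclideanSpace ℝ ι)
  let B₀ : (Fin (Module.finrank ℝ (EuclideanSpace ℝ ι)) → ℝ) →L[ℝ] EuclideanSpace ℝ ι :=
    ∑ i, (ContinuousLinearMap.proj (R := ℝ) (φ := fun _ => ℝ) i).smulRight (b i)
  refine ⟨_, (EuclideanSpace.equiv ι ℝ).toContinuousLinearMap ∘L
    (toEuclideanCLM (𝕜 := ℝ) (CFC.sqrt S)) ∘L B₀, ?_⟩
  rw [hX', hlaw, multivariateGaussian, stdGaussian, Measure.map_map (by fun_prop) (by fun_prop),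
    Measure.map_map (by fun_prop) (by fun_prop)]
  congr 1
  ext x i
  simp [B₀, b]

theorem measurePreserving_neg_pi_gaussianReal (d : ℕ) :
    MeasurePreserving (fun x : Fin d → ℝ => -x) (Measure.pi fun _ => gaussianReal 0 1)
      (Measure.pi fun _ => gaussianReal 0 1) :=
  measurePreserving_pi (f := fun _ x => -x) _ _ fun _ =>
    ⟨measurable_neg, by simp [gaussianReal_map_neg]⟩

/-- Anderson's inequality: the probability that a centered Gaussian vector, translated by `t • v`,
lies in a symmetric convex set is nonincreasing in `|t|`. -/
theorem ProbabilityTheory.HasGaussianLaw.measure_add_smul_mem_anti {X : ι → Ω → ℝ}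
    (hX : HasGaussianLaw (fun ω i => X i ω) P) (h0 : ∀ i, ∫ ω, X i ω ∂P = 0)
    {K : Set (ι → ℝ)} (hKm : MeasurableSet K) (hK : Convex ℝ K) (hKs : ∀ x ∈ K, -x ∈ K)
    (v : ι → ℝ) {s t : ℝ} (hst : |s| ≤ |t|) :
    P.map (fun ω i => X i ω) {x | x + t • v ∈ K} ≤
      P.map (fun ω i => X i ω) {x | x + s • v ∈ K} := by
  obtain ⟨d, B, hB⟩ := hX.exists_map_eq_map_pi h0
  have hBm : Measurable B := B.continuous.measurable
  have hm (t : ℝ) : MeasurableSet {x : ι → ℝ | x + t • v ∈ K} :=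
    hKm.preimage (by fun_prop)
  have hm' (t : ℝ) : MeasurableSet {x | B x + t • v ∈ K} := (hm t).preimage hBm
  have hmap (t : ℝ) : P.map (fun ω i => X i ω) {x | x + t • v ∈ K} =
      (Measure.pi fun _ => gaussianReal 0 1) {x | B x + t • v ∈ K} := by
    rw [hB, Measure.map_apply hBm (hm t)]; rfl
  rw [hmap, hmap]
  set γ : Measure (Fin d → ℝ) := Measure.pi fun _ => gaussianReal 0 1
  have hneg (t : ℝ) : γ {x | B x + (-t) • v ∈ K} = γ {x | B x + t • v ∈ K} := by
    rw [← (measurePreserving_neg_pi_gaussianReal d).measure_preimage (hm' t).nullMeasurableSet]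
    congr 1
    ext x
    have h1 : -(B x + -t • v) = B (-x) + t • v := by rw [map_neg]; module
    have h2 : -(B (-x) + t • v) = B x + -t • v := by rw [map_neg]; module
    constructor <;> intro h
    · change B (-x) + t • v ∈ K
      exact h1 ▸ hKs _ h
    · change B x + -t • v ∈ K
      exact h2 ▸ hKs _ h
  rcases hst.eq_or_lt with h | hlt
  · rcases abs_eq_abs.1 h with rfl | rfl
    · rfl
    · rw [hneg]
  have ht : 0 < |t| := (abs_nonneg s).trans_lt hlt
  have ht0 : t ≠ 0 := abs_pos.1 ht
  have hr : |s / t| < 1 := by rw [abs_div]; exact (div_lt_one ht).2 hlt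
  obtain ⟨hr1, hr2⟩ := abs_lt.1 hr
  -- The point `s` is a convex combination of `t` and `-t`.
  set a := (1 + s / t) / 2 with ha
  set b := (1 - s / t) / 2 with hb
  have ha0 : 0 < a := by rw [ha]; linarith
  have hb0 : 0 < b := by rw [hb]; linarith
  have hab : a + b = 1 := by rw [ha, hb]; ring
  have hs : a * t - b * t = s := by rw [ha, hb]; field_simp; ring
  have key := prekopaLeindler_pi_gaussianReal ha0 hb0 hab d
    (f := {x | B x + t • v ∈ K}.indicator 1) (g := {x | B x + (-t) • v ∈ K}.indicator 1)
    (h := {x | B x + s • v ∈ K}.indicator 1) (measurable_one.indicator (hm' _))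
    (measurable_one.indicator (hm' _)) (measurable_one.indicator (hm' _))
    (fun x => indicator_le_self' (by simp) x) (fun x => indicator_le_self' (by simp) x)
    fun x y => ?_
  · rw [lintegral_indicator_one (hm' _), lintegral_indicator_one (hm' _),
      lintegral_indicator_one (hm' _), hneg,
      ← ENNReal.rpow_add_of_nonneg _ _ ha0.le hb0.le, hab, ENNReal.rpow_one] at key
    exact key
  · by_cases hx : B x + t • v ∈ K
    swap; · simp [indicator, hx, ha0]
    by_cases hy : B y + (-t) • v ∈ K
    swap; · rw [indicator_of_notMem (s := {x | B x + (-t) • v ∈ K}) hy]; simp [hb0]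
    have : B (a • x + b • y) + s • v = a • (B x + t • v) + b • (B y + (-t) • v) := by
      rw [← hs, map_add, map_smul, map_smul]; module
    have hmem : a • x + b • y ∈ {x | B x + s • v ∈ K} := by
      rw [mem_ofPred_eq, this]
      exact hK hx hy ha0.le hb0.le hab
    rw [indicator_of_mem hmem, indicator_of_mem (s := {x | B x + t • v ∈ K}) hx,
      indicator_of_mem (s := {x | B x + (-t) • v ∈ K}) hy]
    simp

/-- Chebyshev's association inequality for a function nonincreasing in `|u|` and the indicator of
`|u| ≤ c`. -/
theorem measure_abs_le_mul_lintegral_le (ν : Measure ℝ) [IsProbabilityMeasure ν] {φ : ℝ → ℝ≥0∞}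
    (hφ : ∀ s t, |s| ≤ |t| → φ t ≤ φ s) (c : ℝ) :
    ν {u | |u| ≤ c} * ∫⁻ u, φ u ∂ν ≤ ∫⁻ u in {u | |u| ≤ c}, φ u ∂ν := by
  rcases lt_or_ge c 0 with hc | hc
  · have : {u : ℝ | |u| ≤ c} = ∅ := by
      ext u; simpa using hc.trans_le (abs_nonneg u)
    simp [this]
  set A := {u : ℝ | |u| ≤ c}
  have hA : MeasurableSet A := measurableSet_le (by fun_prop) (by fun_prop)
  have h1 : φ c * ν A ≤ ∫⁻ u in A, φ u ∂ν := by
    rw [← setLIntegral_const]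
    exact setLIntegral_mono' hA fun u hu => hφ _ _ (hu.trans (le_abs_self c))
  have h2 : ∫⁻ u in Aᶜ, φ u ∂ν ≤ φ c * ν Aᶜ := by
    rw [← setLIntegral_const]
    refine setLIntegral_mono' hA.compl fun u hu => hφ _ _ ?_
    rw [abs_of_nonneg hc]
    exact le_of_not_ge hu
  calc ν A * ∫⁻ u, φ u ∂ν = ν A * ∫⁻ u in A, φ u ∂ν + ν A * ∫⁻ u in Aᶜ, φ u ∂ν := by
        rw [← lintegral_add_compl φ hA, mul_add]
    _ ≤ ν A * (∫⁻ u in A, φ u ∂ν) + ν A * (φ c * ν Aᶜ) := by gcongr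
    _ = ν A * (∫⁻ u in A, φ u ∂ν) + φ c * ν A * ν Aᶜ := by ring
    _ ≤ ν A * (∫⁻ u in A, φ u ∂ν) + (∫⁻ u in A, φ u ∂ν) * ν Aᶜ := by gcongr
    _ = ∫⁻ u in A, φ u ∂ν := by
        rw [mul_comm, ← mul_add, prob_add_prob_compl hA, mul_one]

theorem covariance_eq_zero_of_variance_eq_zero [IsFiniteMeasure P] {U V : Ω → ℝ} (hU : MemLp U 2 P)
    (h : Var[U; P] = 0) : cov[V, U; P] = 0 := by
  refine integral_eq_zero_of_ae ?_
  filter_upwards [ae_eq_integral_of_variance_eq_zero hU h] with ω hω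
  simp [hω]

/-- A symmetric slab in a coordinate direction and a symmetric convex set are positively correlated
under a centered Gaussian law. -/
theorem ProbabilityTheory.HasGaussianLaw.measure_abs_le_mul_le {X : ι → Ω → ℝ}
    (hX : HasGaussianLaw (fun ω i => X i ω) P) (h0 : ∀ i, ∫ ω, X i ω ∂P = 0)
    {K : Set (ι → ℝ)} (hKm : MeasurableSet K) (hK : Convex ℝ K) (hKs : ∀ x ∈ K, -x ∈ K)
    (j : ι) (c : ℝ) :
    P {ω | |X j ω| ≤ c} * P {ω | (fun i => X i ω) ∈ K} ≤
      P {ω | |X j ω| ≤ c ∧ (fun i => X i ω) ∈ K} := by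
  have := hX.isProbabilityMeasure
  have := Fintype.ofFinite ι
  have hXi (i) : HasGaussianLaw (X i) P := hX.eval i
  -- `Y` is the part of `X` that is uncorrelated with, hence independent of, `X j`.
  set v : ι → ℝ := fun i => cov[X i, X j; P] / Var[X j; P] with hv
  set Y : ι → Ω → ℝ := fun i ω => X i ω - v i * X j ω with hY
  have hYX : HasGaussianLaw (fun ω => (fun i => Y i ω, fun _ : Unit => X j ω)) P :=
    hX.map_fun ((ContinuousLinearMap.pi fun i =>
      ContinuousLinearMap.proj (R := ℝ) (φ := fun _ : ι => ℝ) i - v i • .proj j).prod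
        (ContinuousLinearMap.pi fun _ : Unit => .proj j))
  have hcov (i) : cov[Y i, X j; P] = 0 := by
    rw [hY, covariance_fun_sub_left (hXi i).memLp_two ((hXi j).memLp_two.const_mul _)
      (hXi j).memLp_two, covariance_const_mul_left, covariance_self (hXi j).aemeasurable]
    -- If `X j` is constant, then `v = 0` by the convention on division.
    rcases eq_or_ne (Var[X j; P]) 0 with h | h
    · rw [covariance_eq_zero_of_variance_eq_zero (hXi j).memLp_two h, h]; simp
    · simp [hv, div_mul_cancel₀ _ h]
  have hind : IndepFun (fun ω i => Y i ω) (X j) P :=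
    (hYX.indepFun_of_covariance_eval fun i _ => hcov i).comp measurable_id
      (measurable_pi_apply ())
  have hYg : HasGaussianLaw (fun ω i => Y i ω) P := hYX.fst
  have hY0 (i) : ∫ ω, Y i ω ∂P = 0 := by
    rw [hY, integral_sub (hXi i).integrable ((hXi j).integrable.const_mul _), integral_const_mul]
    simp [h0]
  have hprod := (indepFun_iff_map_prod_eq_prod_map_map hYg.aemeasurable (hXi j).aemeasurable).1 hind
  have hXY (ω) : (fun i => X i ω) = (fun i => Y i ω) + X j ω • v := by
    ext i; simp [hY]; ring
  set φ : ℝ → ℝ≥0∞ := fun u => P.map (fun ω i => Y i ω) {x | x + u • v ∈ K} with hφ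
  have hprodm : Measurable fun p : (ι → ℝ) × ℝ => p.1 + p.2 • v := by fun_prop
  have hν : IsProbabilityMeasure (P.map (X j)) :=
    Measure.isProbabilityMeasure_map (hXi j).aemeasurable
  have hset {A : Set ℝ} (hA : MeasurableSet A) :
      P {ω | X j ω ∈ A ∧ (fun i => X i ω) ∈ K} = ∫⁻ u in A, φ u ∂P.map (X j) := by
    have hS : MeasurableSet {p : (ι → ℝ) × ℝ | p.2 ∈ A ∧ p.1 + p.2 • v ∈ K} :=
      (hA.preimage measurable_snd).inter (hKm.preimage hprodm)
    calc P {ω | X j ω ∈ A ∧ (fun i => X i ω) ∈ K}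
        = P.map (fun ω => ((fun i => Y i ω), X j ω)) {p | p.2 ∈ A ∧ p.1 + p.2 • v ∈ K} := by
          rw [Measure.map_apply_of_aemeasurable (hYg.aemeasurable.prodMk (hXi j).aemeasurable) hS]
          congr 1; ext ω; simp [hXY ω]
      _ = ∫⁻ u, A.indicator φ u ∂P.map (X j) := by
          rw [hprod, Measure.prod_apply_symm hS]
          refine lintegral_congr fun u => ?_
          by_cases hu : u ∈ A <;> simp [hu, hφ, preimage]
      _ = ∫⁻ u in A, φ u ∂P.map (X j) := lintegral_indicator hA _
  have hA : MeasurableSet {u : ℝ | |u| ≤ c} := measurableSet_le (by fun_prop) (by fun_prop)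
  have h1 := hset hA
  have h2 := hset MeasurableSet.univ
  simp only [mem_univ, true_and, setLIntegral_univ] at h2
  have h3 : P {ω | |X j ω| ≤ c} = P.map (X j) {u | |u| ≤ c} := by
    rw [Measure.map_apply_of_aemeasurable (hXi j).aemeasurable hA]; rfl
  rw [h2, h3]
  refine le_trans ?_ h1.ge
  exact measure_abs_le_mul_lintegral_le _
    (fun s t hst => hYg.measure_add_smul_mem_anti hY0 hKm hK hKs v hst) c

/-- Šidák's inequality for the coordinates of a centered Gaussian vector. -/
theorem ProbabilityTheory.HasGaussianLaw.prod_measure_abs_le_le {X : ι → Ω → ℝ}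
    (hX : HasGaussianLaw (fun ω i => X i ω) P) (h0 : ∀ i, ∫ ω, X i ω ∂P = 0) (c : ι → ℝ)
    (s : Finset ι) : ∏ i ∈ s, P {ω | |X i ω| ≤ c i} ≤ P {ω | ∀ i ∈ s, |X i ω| ≤ c i} := by
  classical
  have := hX.isProbabilityMeasure
  induction s using Finset.induction_on with
  | empty => simp
  | insert j s hj ih =>
    rw [Finset.prod_insert hj]
    set K : Set (ι → ℝ) := ⋂ i ∈ s, {x | |x i| ≤ c i} with hK
    have hmem (x : ι → ℝ) : x ∈ K ↔ ∀ i ∈ s, |x i| ≤ c i := by simp [hK]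
    have h := hX.measure_abs_le_mul_le h0 (K := K)
      (Finset.measurableSet_biInter _ fun i _ => measurableSet_le (by fun_prop) (by fun_prop))
      (convex_iInter₂ fun i _ => ?_) (fun x hx => ?_) j (c j)
    · simp only [hmem] at h
      simp only [Finset.forall_mem_insert]
      exact (mul_le_mul_right ih _).trans h
    · have : {x : ι → ℝ | |x i| ≤ c i} =
          (LinearMap.proj (R := ℝ) (φ := fun _ => ℝ) i) ⁻¹' Icc (-c i) (c i) := by
        ext x; simp [abs_le]
      rw [this]
      exact (convex_Icc _ _).linear_preimage _
    · rw [hmem] at hx ⊢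
      simpa using hx

end

/-! ### The chi-squared quantile and standard normal variables -/

namespace GPLin

instance isProbabilityMeasure_chiSquared (d : ℕ) : IsProbabilityMeasure (chiSquared d) :=
  Measure.isProbabilityMeasure_map (Measurable.aemeasurable (by fun_prop))

/-- The infimum defining the quantile is attained, by right continuity of the distribution
function. -/
theorem le_cdf_chiSquaredQuantile (d : ℕ) {p : ℝ} (hp : p < 1) :
    p ≤ cdf (chiSquared d) (chiSquaredQuantile d p) := by
  set S := {x : ℝ | 0 ≤ x ∧ p ≤ cdf (chiSquared d) x} with hS
  have hne : S.Nonempty := by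
    obtain ⟨x, hx1, hx2⟩ := (((tendsto_cdf_atTop (chiSquared d)).eventually_const_lt hp).and
      (eventually_ge_atTop 0)).exists
    exact ⟨x, hx2, hx1.le⟩
  have hr : Tendsto (cdf (chiSquared d)) (𝓝[>] sInf S) (𝓝 (cdf (chiSquared d) (sInf S))) :=
    ((cdf (chiSquared d)).right_continuous _).tendsto.mono_left
      (nhdsWithin_mono _ Ioi_subset_Ici_self)
  refine ge_of_tendsto hr ?_
  filter_upwards [self_mem_nhdsWithin] with x hx
  obtain ⟨y, hy, hyx⟩ := exists_lt_of_csInf_lt hne hx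
  exact hy.2.trans (monotone_cdf _ hyx.le)

/-- The cube of half-width `√q` contains the ball of radius `√q`, which has probability at least
`p`. -/
theorem ofReal_le_gaussianReal_abs_le_pow (d : ℕ) {p : ℝ} (hp : p < 1) :
    ENNReal.ofReal p ≤ gaussianReal 0 1 {x | |x| ≤ √(chiSquaredQuantile d p)} ^ d := by
  set q := chiSquaredQuantile d p
  have h1 : ENNReal.ofReal p ≤ chiSquared d (Iic q) := by
    rw [← ofReal_cdf]
    exact ENNReal.ofReal_le_ofReal (le_cdf_chiSquaredQuantile d hp)
  refine h1.trans ?_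
  rw [chiSquared, Measure.map_apply (by fun_prop) measurableSet_Iic]
  calc (Measure.pi fun _ : Fin d => gaussianReal 0 1) ((fun x => ∑ j, x j ^ 2) ⁻¹' Iic q)
      ≤ (Measure.pi fun _ : Fin d => gaussianReal 0 1) (univ.pi fun _ => {x | |x| ≤ √q}) := by
        refine measure_mono fun x hx j _ => ?_
        refine Real.abs_le_sqrt (le_trans ?_ hx)
        exact Finset.single_le_sum (f := fun j => x j ^ 2) (fun j _ => sq_nonneg _)
          (Finset.mem_univ j)
    _ = gaussianReal 0 1 {x | |x| ≤ √q} ^ d := by simp [Measure.pi_pi]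

end GPLin

section

variable {Ω : Type*} [MeasurableSpace Ω] {P : Measure Ω}

/-- A centered Gaussian variable of standard deviation `s` satisfies `|V| ≤ c` with at least the
probability that a standard normal variable satisfies `|x| ≤ r`, as soon as `r * s ≤ c`. -/
theorem ProbabilityTheory.HasGaussianLaw.gaussianReal_abs_le_le {V : Ω → ℝ}
    (hV : HasGaussianLaw V P) (h0 : ∫ ω, V ω ∂P = 0) {r c : ℝ} (hc : r * √(Var[V; P]) ≤ c) :
    gaussianReal 0 1 {x | |x| ≤ r} ≤ P {ω | |V ω| ≤ c} := by
  have hlaw := hV.map_eq_gaussianReal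
  rw [h0] at hlaw
  have hA (c : ℝ) : MeasurableSet {u : ℝ | |u| ≤ c} := measurableSet_le (by fun_prop) (by fun_prop)
  have hmul := gaussianReal_map_const_mul (μ := 0) (v := 1) (√(Var[V; P]))
  have hv : NNReal.mk (√(Var[V; P]) ^ 2) (sq_nonneg _) * 1 = Var[V; P].toNNReal := by
    ext
    simp [Real.sq_sqrt (variance_nonneg V P), Real.coe_toNNReal _ (variance_nonneg V P)]
  have h1 : P {ω | |V ω| ≤ c} = P.map V {u | |u| ≤ c} := by
    rw [Measure.map_apply_of_aemeasurable hV.aemeasurable (hA c)]; rfl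
  rw [mul_zero, hv] at hmul
  rw [h1, hlaw, ← hmul, Measure.map_apply (by fun_prop) (hA c)]
  refine measure_mono fun x (hx : |x| ≤ r) => ?_
  change |√(Var[V; P]) * x| ≤ c
  rw [abs_mul, abs_of_nonneg (Real.sqrt_nonneg _), mul_comm]
  exact (mul_le_mul_of_nonneg_right hx (Real.sqrt_nonneg _)).trans hc

/-! ### Probabilities of closed boxes under almost sure limits -/

theorem le_measure_iInter_of_antitone [IsFiniteMeasure P] {s : ℕ → Set Ω}
    (hs : ∀ k, NullMeasurableSet (s k) P) (hm : Antitone s) {q : ℝ≥0∞} (h : ∀ k, q ≤ P (s k)) :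
    q ≤ P (⋂ k, s k) :=
  ge_of_tendsto (tendsto_measure_iInter_atTop hs hm ⟨0, measure_ne_top _ _⟩)
    (.of_forall h)

/-- A lower bound for the probabilities of slightly enlarged closed boxes, intersected with a fixed
event `A`, survives an almost sure limit. The enlargement is needed because the limit may be
degenerate (`c i = 0` is allowed). -/
theorem le_measure_abs_le_inter_of_tendsto {ι : Type*} [Finite ι] [IsFiniteMeasure P]
    {V : ℕ → ι → Ω → ℝ} {W : ι → Ω → ℝ} (hV : ∀ k i, AEMeasurable (V k i) P)
    (hVW : ∀ᵐ ω ∂P, ∀ i, Tendsto (fun k => V k i ω) atTop (𝓝 (W i ω))) {A : Set Ω}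
    (hA : MeasurableSet A) {c : ι → ℝ} {q : ℝ≥0∞}
    (h : ∀ ε > 0, ∀ᶠ k in atTop, q ≤ P ({ω | ∀ i, |V k i ω| ≤ c i + ε} ∩ A)) :
    q ≤ P ({ω | ∀ i, |W i ω| ≤ c i} ∩ A) := by
  have hW (i) : AEMeasurable (W i) P :=
    aemeasurable_of_tendsto_metrizable_ae' (fun k => hV k i) (hVW.mono fun ω h => h i)
  have hnull {U : ι → Ω → ℝ} (hU : ∀ i, AEMeasurable (U i) P) (b : ι → ℝ) :
      NullMeasurableSet ({ω | ∀ i, |U i ω| ≤ b i} ∩ A) P := by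
    refine NullMeasurableSet.inter ?_ hA.nullMeasurableSet
    simp only [ofPred_forall]
    exact .iInter fun i => nullMeasurableSet_le (by fun_prop) (by fun_prop)
  have hε (ε : ℝ) (hε : 0 < ε) : q ≤ P ({ω | ∀ i, |W i ω| ≤ c i + ε} ∩ A) := by
    have h1 : q ≤ P (⋂ K : ℕ, ⋃ k ≥ K, {ω | ∀ i, |V k i ω| ≤ c i + ε} ∩ A) := by
      refine le_measure_iInter_of_antitone (fun K => .iUnion fun k => .iUnion fun _ =>
        hnull (hV k) _) (fun K L hKL => biUnion_mono (fun k hk => hKL.trans hk) fun _ _ => le_rfl)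
        fun K => ?_
      obtain ⟨k, hk, hkK⟩ := ((h ε hε).and (eventually_ge_atTop K)).exists
      exact hk.trans (measure_mono (subset_biUnion_of_mem (u := fun k =>
        {ω | ∀ i, |V k i ω| ≤ c i + ε} ∩ A) hkK))
    refine h1.trans (measure_mono_ae ?_)
    filter_upwards [hVW] with ω hω hmem
    have hfreq : ∃ᶠ k in atTop, ω ∈ {ω | ∀ i, |V k i ω| ≤ c i + ε} ∩ A := by
      rw [frequently_atTop]
      intro K
      obtain ⟨k, hk, h⟩ := mem_iUnion₂.1 (mem_iInter.1 hmem K)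
      exact ⟨k, hk, h⟩
    exact ⟨fun i => le_of_tendsto_of_frequently (hω i).abs (hfreq.mono fun k hk => hk.1 i),
      hfreq.exists.choose_spec.2⟩
  have hlim : {ω | ∀ i, |W i ω| ≤ c i} ∩ A =
      ⋂ K : ℕ, {ω | ∀ i, |W i ω| ≤ c i + 1 / ((K : ℝ) + 1)} ∩ A := by
    ext ω
    simp only [mem_inter_iff, mem_iInter]
    refine ⟨fun hω K => ⟨fun i => (hω.1 i).trans (le_add_of_nonneg_right (by positivity)), hω.2⟩,
      fun hω => ⟨fun i => ?_, (hω 0).2⟩⟩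
    have := (tendsto_one_div_add_atTop_nhds_zero_nat (𝕜 := ℝ)).const_add (c i)
    rw [add_zero] at this
    exact ge_of_tendsto' this fun K => (hω K).1 i
  rw [hlim]
  refine le_measure_iInter_of_antitone (fun K => hnull hW _) (fun K L hKL ω hω => ⟨fun i =>
    (hω.1 i).trans (by gcongr), hω.2⟩) fun K => hε _ (by positivity)

/-- A conditional probability is at least `q` if `q * μ A ≤ μ (E ∩ A)` for all conditioning events
`A`. -/
theorem ae_le_condExp_indicator {α : Type*} {m mα : MeasurableSpace α} {μ : Measure α}
    [IsFiniteMeasure μ] (hm : m ≤ mα) {E : Set α} (hE : NullMeasurableSet E μ) {q : ℝ}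
    (h : ∀ A, MeasurableSet[m] A → q * μ.real A ≤ μ.real (E ∩ A)) :
    ∀ᵐ ω ∂μ, q ≤ (μ⟦E | m⟧) ω := by
  have hint : Integrable (E.indicator fun _ => (1 : ℝ)) μ :=
    (integrable_const (1 : ℝ)).indicator₀ hE
  refine ae_le_of_ae_le_trim (hm := hm) ?_
  refine ae_le_of_forall_setIntegral_le (integrable_const _) (integrable_condExp.trim hm
    stronglyMeasurable_condExp) fun A hA _ => ?_
  rw [← setIntegral_trim hm stronglyMeasurable_condExp hA, setIntegral_condExp hm hint hA,
    ← setIntegral_trim hm stronglyMeasurable_const hA,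
    integral_indicator₀ (hE.mono_ac Measure.restrict_le_self.absolutelyContinuous)]
  simpa [Measure.real, Measure.restrict_apply' (hm A hA), mul_comm] using h A hA

end

/-! ### Derivatives of the squared-exponential kernel -/

namespace GPLin

variable {n m : ℕ}

theorem partialDeriv_eq_of_hasDerivAt {F : StateInput n m → ℝ} {z : StateInput n m}
    (hF : DifferentiableAt ℝ F z) {j : Fin n ⊕ Fin m} {F' : ℝ}
    (h : HasDerivAt (fun t : ℝ => F (z + t • Pi.single j 1)) F' 0) : partialDeriv F z j = F' := by
  rw [partialDeriv, ← hF.lineDeriv_eq_fderiv, lineDeriv, h.deriv]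

theorem tendsto_slope_partialDeriv {F : StateInput n m → ℝ} {z : StateInput n m}
    (hF : DifferentiableAt ℝ F z) (j : Fin n ⊕ Fin m) {h : ℕ → ℝ} (h0 : ∀ k, h k ≠ 0)
    (hh : Tendsto h atTop (𝓝 0)) :
    Tendsto (fun k => (F (z + h k • Pi.single j 1) - F z) / h k) atTop
      (𝓝 (partialDeriv F z j)) := by
  have hd : HasDerivAt (fun t : ℝ => F (z + t • Pi.single j 1)) (partialDeriv F z j) 0 :=
    hF.hasFDerivAt.hasLineDerivAt _
  have := (hasDerivAt_iff_tendsto_slope.1 hd).comp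
    (tendsto_nhdsWithin_iff.2 ⟨hh, .of_forall fun k => h0 k⟩)
  refine this.congr fun k => ?_
  simp [slope_def_field]

variable (σ : ℝ) (l : Fin n ⊕ Fin m → ℝ)

theorem seKernel_comm (z z' : StateInput n m) : seKernel σ l z z' = seKernel σ l z' z := by
  simp only [seKernel]
  congr 4
  ext j; ring

theorem seKernel_self (z : StateInput n m) : seKernel σ l z z = σ ^ 2 := by
  simp [seKernel]

/-- The kernel along a line in the direction of the coordinate `j`. The identity also holds for
`l j = 0`, where division by zero drops the coordinate `j`. -/
theorem seKernel_add_smul_single (z z' : StateInput n m) (t : ℝ) (j : Fin n ⊕ Fin m) :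
    seKernel σ l z (z' + t • Pi.single j 1) =
      seKernel σ l z z' * Real.exp (t * (z j - z' j) / l j ^ 2 - t ^ 2 / (2 * l j ^ 2)) := by
  have : ∑ i, (z i - (z' + t • Pi.single j 1 : StateInput n m) i) ^ 2 / l i ^ 2 =
      (∑ i, (z i - z' i) ^ 2 / l i ^ 2) + (t ^ 2 - 2 * t * (z j - z' j)) / l j ^ 2 := by
    rw [← sub_eq_iff_eq_add', ← Finset.sum_sub_distrib, Finset.sum_eq_single j]
    · simp; ring
    · intro i _ hi; simp [hi]
    · simp
  rw [seKernel, this, seKernel, mul_assoc (σ ^ 2), ← Real.exp_add]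
  congr 2
  by_cases hl : l j = 0
  · simp [hl]
  · field_simp; ring

theorem differentiable_seKernel (z : StateInput n m) :
    Differentiable ℝ fun z' => seKernel σ l z z' := by
  unfold seKernel
  fun_prop

theorem partialDeriv_seKernel (z z' : StateInput n m) (j : Fin n ⊕ Fin m) :
    partialDeriv (fun z'' => seKernel σ l z z'') z' j =
      seKernel σ l z z' * ((z j - z' j) / l j ^ 2) := by
  refine partialDeriv_eq_of_hasDerivAt (differentiable_seKernel σ l z z') ?_
  simp only [seKernel_add_smul_single]
  refine HasDerivAt.const_mul _ ?_
  have h1 : HasDerivAt (fun t : ℝ => t * (z j - z' j) / l j ^ 2 - t ^ 2 / (2 * l j ^ 2))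
      ((z j - z' j) / l j ^ 2) 0 := by
    have := (((hasDerivAt_id (0 : ℝ)).mul_const (z j - z' j)).div_const (l j ^ 2)).sub
      (((hasDerivAt_id (0 : ℝ)).pow 2).div_const (2 * l j ^ 2))
    convert! this using 1
    simp
  simpa using h1.exp

theorem kernelHess_seKernel_self (z : StateInput n m) (j : Fin n ⊕ Fin m) :
    kernelHess (seKernel σ l) z j j = σ ^ 2 / l j ^ 2 := by
  simp only [kernelHess, of_apply, partialDeriv_seKernel]
  have hd : Differentiable ℝ fun z₁ : StateInput n m => seKernel σ l z₁ z := by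
    simpa only [seKernel_comm σ l _ z] using differentiable_seKernel σ l z
  refine partialDeriv_eq_of_hasDerivAt (by fun_prop) ?_
  have h1 : HasDerivAt (fun t : ℝ => Real.exp (-t ^ 2 / (2 * l j ^ 2))) 0 0 := by
    have := (((hasDerivAt_id (0 : ℝ)).pow 2).neg.div_const (2 * l j ^ 2)).exp
    simpa using this
  have h2 := (h1.const_mul (σ ^ 2)).mul ((hasDerivAt_id (0 : ℝ)).div_const (l j ^ 2))
  convert! h2 using 1
  · ext t
    rw [seKernel_comm, seKernel_add_smul_single, seKernel_self]
    simp [neg_div]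
  · simp [div_eq_mul_inv]

/-- The variance of a difference quotient of the process converges to the prior variance of the
partial derivative. -/
theorem tendsto_seKernel_second_difference (z : StateInput n m) (j : Fin n ⊕ Fin m) {h : ℕ → ℝ}
    (h0 : ∀ k, h k ≠ 0) (hh : Tendsto h atTop (𝓝 0)) :
    Tendsto (fun k => (seKernel σ l (z + h k • Pi.single j 1) (z + h k • Pi.single j 1) -
      2 * seKernel σ l z (z + h k • Pi.single j 1) + seKernel σ l z z) / h k ^ 2) atTop
      (𝓝 (kernelHess (seKernel σ l) z j j)) := by
  rw [kernelHess_seKernel_self]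
  have hd : HasDerivAt (fun s : ℝ => -(2 * σ ^ 2) * Real.exp (-s / (2 * l j ^ 2)))
      (σ ^ 2 / l j ^ 2) 0 := by
    have := (((hasDerivAt_id (0 : ℝ)).neg.div_const (2 * l j ^ 2)).exp).const_mul (-(2 * σ ^ 2))
    convert! this using 1
    simp only [Pi.neg_apply, id, neg_zero, zero_div, Real.exp_zero, one_mul]
    by_cases hl : l j = 0
    · simp [hl]
    · field_simp
  have hh2 : Tendsto (fun k => h k ^ 2) atTop (𝓝 0) := by simpa using hh.pow 2
  have := (hasDerivAt_iff_tendsto_slope.1 hd).comp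
    (tendsto_nhdsWithin_iff.2 ⟨hh2, .of_forall fun k => pow_ne_zero 2 (h0 k)⟩)
  refine this.congr fun k => ?_
  simp only [Function.comp, slope_def_field, seKernel_add_smul_single, seKernel_self, sub_self,
    mul_zero, zero_div, zero_sub, neg_zero, Real.exp_zero, sub_zero, mul_one]
  simp only [neg_div]
  ring

end GPLin

/-! ### Residuals of difference quotients -/

namespace GPLin

variable {Ω : Type*} {n m N : ℕ}

/-- The observation of the component `i` at the input `z a`. -/
def observation (G : Fin n → StateInput n m → Ω → ℝ) (W : Fin N → Fin n → Ω → ℝ)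
    (z : Fin N → StateInput n m) (a : Fin N) (i : Fin n) (ω : Ω) : ℝ :=
  G i (z a) ω + W a i ω

/-- The difference quotient of `F` at `s` with step `h` in the direction of the coordinate `j`. -/
def diffQuot (F : StateInput n m → Ω → ℝ) (s : StateInput n m) (h : ℝ) (j : Fin n ⊕ Fin m)
    (ω : Ω) : ℝ :=
  (F (s + h • Pi.single j 1) ω - F s ω) / h

theorem diffQuot_eq (F : StateInput n m → Ω → ℝ) (s : StateInput n m) (h : ℝ)
    (j : Fin n ⊕ Fin m) :
    diffQuot F s h j = fun ω => (F (s + h • Pi.single j 1) ω - F s ω) / h := rfl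

/-- The covariances of the difference quotients at `s` with the values at the `z a`; a
discretization of `crossDeriv`. -/
def crossDiff (k : StateInput n m → StateInput n m → ℝ) (z : Fin N → StateInput n m)
    (s : StateInput n m) (h : ℝ) : Matrix (Fin n ⊕ Fin m) (Fin N) ℝ :=
  Matrix.of fun j a => (k (z a) (s + h • Pi.single j 1) - k (z a) s) / h

/-- The error of the best linear prediction of a difference quotient of `G i` from the observations
of the component `i`. -/
def diffResidual (G : Fin n → StateInput n m → Ω → ℝ) (W : Fin N → Fin n → Ω → ℝ)
    (k : Fin n → StateInput n m → StateInput n m → ℝ) (S : Matrix (Fin n) (Fin n) ℝ)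
    (z : Fin N → StateInput n m) (s : StateInput n m) (h : ℝ) (i : Fin n) (j : Fin n ⊕ Fin m)
    (ω : Ω) : ℝ :=
  diffQuot (G i) s h j ω -
    ∑ a, (crossDiff (k i) z s h * (noisyGram (k i) (S i i) z)⁻¹) j a * observation G W z a i ω

theorem diffResidual_eq (G : Fin n → StateInput n m → Ω → ℝ) (W : Fin N → Fin n → Ω → ℝ)
    (k : Fin n → StateInput n m → StateInput n m → ℝ) (S : Matrix (Fin n) (Fin n) ℝ)
    (z : Fin N → StateInput n m) (s : StateInput n m) (h : ℝ) (i : Fin n) (j : Fin n ⊕ Fin m) :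
    diffResidual G W k S z s h i j = fun ω => diffQuot (G i) s h j ω -
      ∑ a, (crossDiff (k i) z s h * (noisyGram (k i) (S i i) z)⁻¹) j a *
        observation G W z a i ω := rfl

variable [MeasurableSpace Ω] {P : Measure Ω}

/-- The components `G i` of a random function on the state-input space and the noise components
`W a i` are jointly Gaussian and centered; the `G i` are uncorrelated with covariance functions
`k i`, the noise vectors `W a` are uncorrelated with covariance matrix `S`, and the function is
uncorrelated with the noise. -/
structure IsNoisyGP (G : Fin n → StateInput n m → Ω → ℝ) (W : Fin N → Fin n → Ω → ℝ)
    (k : Fin n → StateInput n m → StateInput n m → ℝ) (S : Matrix (Fin n) (Fin n) ℝ)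
    (P : Measure Ω) : Prop where
  gaussian : ∀ {T : Type} [Fintype T] (τ : T → StateInput n m),
    HasGaussianLaw (fun ω => (fun i t => G i (τ t) ω, fun a i => W a i ω)) P
  integral_fun : ∀ i s, ∫ ω, G i s ω ∂P = 0
  integral_noise : ∀ a i, ∫ ω, W a i ω ∂P = 0
  cov_fun : ∀ i i' s t, cov[G i s, G i' t; P] = if i = i' then k i s t else 0
  cov_noise : ∀ a b i i', cov[W a i, W b i'; P] = if a = b then S i i' else 0
  cov_fun_noise : ∀ i s a i', cov[G i s, W a i'; P] = 0

namespace IsNoisyGP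

variable {G : Fin n → StateInput n m → Ω → ℝ} {W : Fin N → Fin n → Ω → ℝ}
  {k : Fin n → StateInput n m → StateInput n m → ℝ} {S : Matrix (Fin n) (Fin n) ℝ}

theorem isProbabilityMeasure (H : IsNoisyGP G W k S P) : IsProbabilityMeasure P :=
  (H.gaussian (fun _ : Unit => 0)).isProbabilityMeasure

theorem memLp_fun (H : IsNoisyGP G W k S P) (i : Fin n) (s : StateInput n m) :
    MemLp (G i s) 2 P :=
  (((H.gaussian (fun _ : Unit => s)).fst.eval i).eval ()).memLp_two

theorem memLp_noise (H : IsNoisyGP G W k S P) (a : Fin N) (i : Fin n) : MemLp (W a i) 2 P :=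
  (((H.gaussian (fun _ : Unit => 0)).snd.eval a).eval i).memLp_two

variable (z : Fin N → StateInput n m) (s : StateInput n m) (h : ℝ)

theorem memLp_observation (H : IsNoisyGP G W k S P) (a : Fin N) (i : Fin n) :
    MemLp (observation G W z a i) 2 P :=
  (H.memLp_fun i _).add (H.memLp_noise a i)

theorem memLp_diffQuot (H : IsNoisyGP G W k S P) (i : Fin n) (j : Fin n ⊕ Fin m) :
    MemLp (diffQuot (G i) s h j) 2 P := by
  rw [diffQuot_eq]
  simp only [div_eq_mul_inv]
  exact ((H.memLp_fun i (s + h • Pi.single j 1)).sub (H.memLp_fun i s)).mul_const h⁻¹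

theorem cov_fun_observation (H : IsNoisyGP G W k S P) (i i' : Fin n) (t : StateInput n m)
    (a : Fin N) : cov[G i t, observation G W z a i'; P] = if i = i' then k i t (z a) else 0 := by
  have := H.isProbabilityMeasure
  change cov[G i t, G i' (z a) + W a i'; P] = _
  rw [covariance_add_right (H.memLp_fun _ _) (H.memLp_fun _ _) (H.memLp_noise _ _), H.cov_fun,
    H.cov_fun_noise, add_zero]

theorem cov_observation (H : IsNoisyGP G W k S P) (i i' : Fin n) (a b : Fin N) :
    cov[observation G W z a i, observation G W z b i'; P] =
      (if i = i' then k i (z a) (z b) else 0) + if a = b then S i i' else 0 := by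
  have := H.isProbabilityMeasure
  change cov[G i (z a) + W a i, observation G W z b i'; P] = _
  rw [covariance_add_left (H.memLp_fun _ _) (H.memLp_noise _ _) (H.memLp_observation z _ _),
    H.cov_fun_observation]
  congr 1
  change cov[W a i, G i' (z b) + W b i'; P] = _
  rw [covariance_add_right (H.memLp_noise _ _) (H.memLp_fun _ _) (H.memLp_noise _ _),
    H.cov_noise, covariance_comm, H.cov_fun_noise, zero_add]

theorem kernel_comm (H : IsNoisyGP G W k S P) (i : Fin n) (t t' : StateInput n m) :
    k i t t' = k i t' t := by
  have h1 := H.cov_fun i i t t'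
  have h2 := H.cov_fun i i t' t
  rw [covariance_comm] at h2
  simpa using h1.symm.trans h2

theorem cov_diffQuot_observation (H : IsNoisyGP G W k S P) (i i' : Fin n) (j : Fin n ⊕ Fin m)
    (a : Fin N) : cov[diffQuot (G i) s h j, observation G W z a i'; P] =
      if i = i' then crossDiff (k i) z s h j a else 0 := by
  have := H.isProbabilityMeasure
  rw [diffQuot_eq]
  rw [covariance_fun_div_left, covariance_fun_sub_left (H.memLp_fun _ _) (H.memLp_fun _ _)
    (H.memLp_observation z _ _), H.cov_fun_observation, H.cov_fun_observation]
  split_ifs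
  · simp [crossDiff, H.kernel_comm i (z a)]
  · simp

theorem cov_diffQuot_self (H : IsNoisyGP G W k S P) (i : Fin n) (j : Fin n ⊕ Fin m) :
    cov[diffQuot (G i) s h j, diffQuot (G i) s h j; P] =
      (k i (s + h • Pi.single j 1) (s + h • Pi.single j 1) -
        2 * k i s (s + h • Pi.single j 1) + k i s s) / h ^ 2 := by
  have := H.isProbabilityMeasure
  rw [diffQuot_eq]
  rw [covariance_fun_div_left, covariance_fun_div_right, covariance_fun_sub_fun_sub
    (H.memLp_fun _ _) (H.memLp_fun _ _) (H.memLp_fun _ _) (H.memLp_fun _ _)]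
  simp only [H.cov_fun, if_true]
  rw [H.kernel_comm i (s + h • Pi.single j 1) s]
  ring

theorem cov_diffResidual_left (H : IsNoisyGP G W k S P) (i : Fin n) (j : Fin n ⊕ Fin m)
    {V : Ω → ℝ} (hV : MemLp V 2 P) :
    cov[diffResidual G W k S z s h i j, V; P] = cov[diffQuot (G i) s h j, V; P] -
      ∑ a, (crossDiff (k i) z s h * (noisyGram (k i) (S i i) z)⁻¹) j a *
        cov[observation G W z a i, V; P] := by
  have := H.isProbabilityMeasure
  rw [diffResidual_eq]
  rw [covariance_fun_sub_left (H.memLp_diffQuot s h i j)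
    (memLp_finsetSum _ fun a _ => (H.memLp_observation z a i).const_mul _) hV,
    covariance_fun_sum_left (fun a => (H.memLp_observation z a i).const_mul _) hV]
  simp only [covariance_const_mul_left]

/-- The residual is uncorrelated with the observations it is computed from: its coefficients
`d K̄⁻¹`, where `d` is the row of `crossDiff`, satisfy the normal equations `(d K̄⁻¹) K̄ = d`. -/
theorem cov_diffResidual_observation_self (H : IsNoisyGP G W k S P) (i : Fin n)
    (j : Fin n ⊕ Fin m) (hK : IsUnit (noisyGram (k i) (S i i) z).det) (b : Fin N) :
    cov[diffResidual G W k S z s h i j, observation G W z b i; P] = 0 := by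
  rw [H.cov_diffResidual_left z s h i j (H.memLp_observation z b i), H.cov_diffQuot_observation,
    if_pos rfl, sub_eq_zero]
  have hb (a : Fin N) : cov[observation G W z a i, observation G W z b i; P] =
      noisyGram (k i) (S i i) z a b := by
    rw [H.cov_observation, if_pos rfl]
    simp [noisyGram, one_apply]
  simp only [hb]
  rw [← mul_apply, Matrix.mul_assoc, nonsing_inv_mul _ hK, Matrix.mul_one]

theorem cov_diffResidual_observation (H : IsNoisyGP G W k S P) (hS : S.IsDiag)
    (hK : ∀ i, IsUnit (noisyGram (k i) (S i i) z).det) (i i' : Fin n) (j : Fin n ⊕ Fin m)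
    (b : Fin N) : cov[diffResidual G W k S z s h i j, observation G W z b i'; P] = 0 := by
  rcases eq_or_ne i i' with rfl | hii
  · exact H.cov_diffResidual_observation_self z s h i j (hK i) b
  · rw [H.cov_diffResidual_left z s h i j (H.memLp_observation z b i'),
      H.cov_diffQuot_observation, if_neg hii]
    simp [H.cov_observation, hii, hS hii]

theorem memLp_diffResidual (H : IsNoisyGP G W k S P) (i : Fin n) (j : Fin n ⊕ Fin m) :
    MemLp (diffResidual G W k S z s h i j) 2 P :=
  (H.memLp_diffQuot s h i j).sub
    (memLp_finsetSum _ fun a _ => (H.memLp_observation z a i).const_mul _)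

theorem variance_diffResidual (H : IsNoisyGP G W k S P) (i : Fin n) (j : Fin n ⊕ Fin m)
    (hK : IsUnit (noisyGram (k i) (S i i) z).det) :
    Var[diffResidual G W k S z s h i j; P] =
      (k i (s + h • Pi.single j 1) (s + h • Pi.single j 1) -
        2 * k i s (s + h • Pi.single j 1) + k i s s) / h ^ 2 -
      (crossDiff (k i) z s h * (noisyGram (k i) (S i i) z)⁻¹ * (crossDiff (k i) z s h)ᵀ) j j := by
  rw [← covariance_self (H.memLp_diffResidual z s h i j).aemeasurable,
    H.cov_diffResidual_left z s h i j (H.memLp_diffResidual z s h i j),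
    covariance_comm, H.cov_diffResidual_left z s h i j (H.memLp_diffQuot s h i j),
    H.cov_diffQuot_self]
  simp only [covariance_comm (observation G W z _ i),
    H.cov_diffResidual_observation_self z s h i j hK, H.cov_diffQuot_observation]
  simp [mul_apply (M := crossDiff (k i) z s h * (noisyGram (k i) (S i i) z)⁻¹)]

theorem integral_diffResidual (H : IsNoisyGP G W k S P) (i : Fin n) (j : Fin n ⊕ Fin m) :
    ∫ ω, diffResidual G W k S z s h i j ω ∂P = 0 := by
  have := H.isProbabilityMeasure
  have hG (i s) : Integrable (G i s) P := (H.memLp_fun i s).integrable one_le_two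
  have hW (a i) : Integrable (W a i) P := (H.memLp_noise a i).integrable one_le_two
  have hy (a) : ∫ ω, observation G W z a i ω ∂P = 0 := by
    simp only [observation]
    rw [integral_add (hG _ _) (hW _ _), H.integral_fun, H.integral_noise, add_zero]
  have hd : ∫ ω, diffQuot (G i) s h j ω ∂P = 0 := by
    simp only [diffQuot]
    rw [integral_div, integral_sub (hG _ _) (hG _ _), H.integral_fun, H.integral_fun]
    simp
  simp only [diffResidual]
  rw [integral_sub ((H.memLp_diffQuot s h i j).integrable one_le_two)
    (integrable_finsetSum _ fun a _ =>
      ((H.memLp_observation z a i).integrable one_le_two).const_mul _), hd,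
    integral_finsetSum _ fun a _ =>
      ((H.memLp_observation z a i).integrable one_le_two).const_mul _]
  simp [integral_const_mul, hy]

theorem hasGaussianLaw_diffResidual_observation (H : IsNoisyGP G W k S P) :
    HasGaussianLaw (fun ω =>
      (fun x : Fin n × (Fin n ⊕ Fin m) => diffResidual G W k S z s h x.1 x.2 ω,
        fun x : Fin N × Fin n => observation G W z x.1 x.2 ω)) P := by
  let τ : Option (Fin n ⊕ Fin m) ⊕ Fin N → StateInput n m :=
    Sum.elim (fun o => o.elim s fun j => s + h • Pi.single j 1) z
  let c (i : Fin n) (j : Fin n ⊕ Fin m) (a : Fin N) : ℝ :=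
    (crossDiff (k i) z s h * (noisyGram (k i) (S i i) z)⁻¹) j a
  let L : ((Fin n → (Option (Fin n ⊕ Fin m) ⊕ Fin N) → ℝ) × (Fin N → Fin n → ℝ)) →ₗ[ℝ]
      ((Fin n × (Fin n ⊕ Fin m) → ℝ) × (Fin N × Fin n → ℝ)) :=
    { toFun := fun v =>
        (fun x => (v.1 x.1 (.inl (some x.2)) - v.1 x.1 (.inl none)) / h -
          ∑ a, c x.1 x.2 a * (v.1 x.1 (.inr a) + v.2 a x.1),
        fun x => v.1 x.2 (.inr x.1) + v.2 x.1 x.2)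
      map_add' := fun v v' => by
        ext x
        · simp only [Prod.fst_add, Prod.snd_add, Pi.add_apply]
          rw [sub_add_sub_comm, ← Finset.sum_add_distrib]
          congr 1
          · ring
          · exact Finset.sum_congr rfl fun a _ => by ring
        · simp only [Prod.fst_add, Prod.snd_add, Pi.add_apply]
          ring
      map_smul' := fun r v => by
        ext x
        · simp only [Prod.smul_fst, Prod.smul_snd, Pi.smul_apply, smul_eq_mul, RingHom.id_apply,
            mul_sub, Finset.mul_sum]
          congr 1
          · ring
          · exact Finset.sum_congr rfl fun a _ => by ring
        · simp only [Prod.smul_fst, Prod.smul_snd, Pi.smul_apply, smul_eq_mul, RingHom.id_apply]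
          ring }
  exact (H.gaussian τ).map_fun (LinearMap.toContinuousLinearMap L)

theorem indepFun_diffResidual_observation (H : IsNoisyGP G W k S P) (hS : S.IsDiag)
    (hK : ∀ i, IsUnit (noisyGram (k i) (S i i) z).det) :
    IndepFun (fun ω (x : Fin n × (Fin n ⊕ Fin m)) => diffResidual G W k S z s h x.1 x.2 ω)
      (fun ω (x : Fin N × Fin n) => observation G W z x.1 x.2 ω) P :=
  (H.hasGaussianLaw_diffResidual_observation z s h).indepFun_of_covariance_eval
    (X := fun x : Fin n × (Fin n ⊕ Fin m) => diffResidual G W k S z s h x.1 x.2)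
    (Y := fun x : Fin N × Fin n => observation G W z x.1 x.2)
    fun x y => H.cov_diffResidual_observation z s h hS hK x.1 y.2 x.2 y.1

end IsNoisyGP

end GPLin

/-! ### Passage to the gradient and the uncertainty box -/

namespace GPLin

variable {Ω : Type*} {n m N : ℕ}

theorem tendsto_crossDiff (σ : ℝ) (l : Fin n ⊕ Fin m → ℝ) (z : Fin N → StateInput n m)
    (s : StateInput n m) {h : ℕ → ℝ} (h0 : ∀ k, h k ≠ 0) (hh : Tendsto h atTop (𝓝 0)) :
    Tendsto (fun k => crossDiff (seKernel σ l) z s (h k)) atTop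
      (𝓝 (crossDeriv (seKernel σ l) z s)) :=
  tendsto_pi_nhds.2 fun j => tendsto_pi_nhds.2 fun a =>
    tendsto_slope_partialDeriv (differentiable_seKernel σ l (z a) s) j h0 hh

theorem targets_apply (f : StateInput n m → Fin n → ℝ) (g : Ω → StateInput n m → Fin n → ℝ)
    (w : Fin N → Ω → EuclideanSpace ℝ (Fin n)) (z : Fin N → StateInput n m) (ω : Ω) (a : Fin N)
    (i : Fin n) : targets f g w z ω a i =
      observation (fun i s ω => g ω s i) (fun a i ω => w a ω i) z a i ω := by
  simp [targets, dynamics, observation]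

theorem jacobian_mem_uncertaintyBox_iff {f : StateInput n m → Fin n → ℝ} (hf : ContDiff ℝ 1 f)
    {g : Ω → StateInput n m → Fin n → ℝ} {ω : Ω} (hg : ContDiff ℝ 1 (g ω))
    (k : Fin n → StateInput n m → StateInput n m → ℝ) (s : Fin n → ℝ)
    (z : Fin N → StateInput n m) (y : Fin N → Fin n → ℝ) (zs : StateInput n m) (p : ℝ) :
    jacobian (dynamics f g ω) zs ∈ uncertaintyBox f k s z y zs p ↔
      ∀ x : Fin n × (Fin n ⊕ Fin m), |partialDeriv (fun t => g ω t x.1) zs x.2 -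
        postDerivMean (k x.1) (s x.1) z (fun a => y a x.1) zs x.2| ≤
        √(chiSquaredQuantile (n + m) p) * √(postDerivCov (k x.1) (s x.1) z zs x.2 x.2) := by
  have hj (i j) : jacobian (dynamics f g ω) zs i j =
      jacobian f zs i j + partialDeriv (fun t => g ω t i) zs j := by
    have hfi : DifferentiableAt ℝ (fun t => f t i) zs :=
      differentiableAt_pi.1 (hf.differentiable one_ne_zero zs) i
    have hgi : DifferentiableAt ℝ (fun t => g ω t i) zs :=
      differentiableAt_pi.1 (hg.differentiable one_ne_zero zs) i
    simp only [jacobian, of_apply, partialDeriv, dynamics, Pi.add_apply]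
    rw [fderiv_fun_add hfi hgi]
    rfl
  rw [Prod.forall]
  refine forall₂_congr fun i j => ?_
  rw [hj, abs_le]
  simp only [nominalJacobian, jacobianRadius, Matrix.sub_apply, Matrix.add_apply, Matrix.smul_apply,
    of_apply, smul_eq_mul]
  constructor <;> rintro ⟨h1, h2⟩ <;> constructor <;> linarith

variable [MeasurableSpace Ω] {P : Measure Ω}

/-- If the residuals of the difference quotients are independent of the event `A`, then, given `A`,
all entries of the residual of the gradient lie within their bounds with probability at least
`p ^ n`. -/
theorem IsNoisyGP.ofReal_pow_mul_le {G : Fin n → StateInput n m → Ω → ℝ}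
    {W : Fin N → Fin n → Ω → ℝ} {σ : Fin n → ℝ} {l : Fin n → Fin n ⊕ Fin m → ℝ}
    {S : Matrix (Fin n) (Fin n) ℝ}
    (H : IsNoisyGP G W (fun i => seKernel (σ i) (l i)) S P) (z : Fin N → StateInput n m)
    (hK : ∀ i, IsUnit (noisyGram (seKernel (σ i) (l i)) (S i i) z).det) (s : StateInput n m)
    (hdiff : ∀ᵐ ω ∂P, ∀ i, DifferentiableAt ℝ (fun t => G i t ω) s)
    {p : ℝ} (hp1 : p < 1) {A : Set Ω} (hA : MeasurableSet A)
    (hind : ∀ h : ℝ, ∀ B : Set (Fin n × (Fin n ⊕ Fin m) → ℝ), MeasurableSet B →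
      P ({ω | (fun x => diffResidual G W (fun i => seKernel (σ i) (l i)) S z s h x.1 x.2 ω) ∈ B}
          ∩ A) = P {ω | (fun x => diffResidual G W (fun i => seKernel (σ i) (l i)) S z s h x.1 x.2 ω) ∈ B}
          * P A) :
    ENNReal.ofReal p ^ n * P A ≤ P ({ω | ∀ x : Fin n × (Fin n ⊕ Fin m),
      |partialDeriv (fun t => G x.1 t ω) s x.2 -
        postDerivMean (seKernel (σ x.1) (l x.1)) (S x.1 x.1) z
          (fun a => observation G W z a x.1 ω) s x.2| ≤
        √(chiSquaredQuantile (n + m) p) *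
          √(postDerivCov (seKernel (σ x.1) (l x.1)) (S x.1 x.1) z s x.2 x.2)} ∩ A) := by
  have := H.isProbabilityMeasure
  set q := chiSquaredQuantile (n + m) p
  set K : Fin n → StateInput n m → StateInput n m → ℝ := fun i => seKernel (σ i) (l i)
  let h (k : ℕ) : ℝ := 1 / ((k : ℝ) + 1)
  have h0 (k) : h k ≠ 0 := by positivity
  have hh : Tendsto h atTop (𝓝 0) := tendsto_one_div_add_atTop_nhds_zero_nat
  have hcoef (i : Fin n) (j : Fin n ⊕ Fin m) (a : Fin N) : Tendsto (fun k =>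
      (crossDiff (K i) z s (h k) * (noisyGram (K i) (S i i) z)⁻¹) j a) atTop
      (𝓝 ((crossDeriv (K i) z s * (noisyGram (K i) (S i i) z)⁻¹) j a)) := by
    have hc : Continuous fun M : Matrix (Fin n ⊕ Fin m) (Fin N) ℝ =>
        M * (noisyGram (K i) (S i i) z)⁻¹ := continuous_id.matrix_mul continuous_const
    have := (hc.tendsto _).comp (tendsto_crossDiff (σ i) (l i) z s h0 hh)
    exact (tendsto_pi_nhds.1 (tendsto_pi_nhds.1 this j) a)
  have hvar (i : Fin n) (j : Fin n ⊕ Fin m) : Tendsto (fun k =>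
      √q * √(Var[diffResidual G W K S z s (h k) i j; P])) atTop
      (𝓝 (√q * √(postDerivCov (K i) (S i i) z s j j))) := by
    refine ((Real.continuous_sqrt.tendsto _).comp ?_).const_mul _
    have hc : Continuous fun M : Matrix (Fin n ⊕ Fin m) (Fin N) ℝ =>
        M * (noisyGram (K i) (S i i) z)⁻¹ * Mᵀ :=
      (continuous_id.matrix_mul continuous_const).matrix_mul continuous_id.matrix_transpose
    have h2 := (hc.tendsto _).comp (tendsto_crossDiff (σ i) (l i) z s h0 hh)
    have h3 := (tendsto_seKernel_second_difference (σ i) (l i) s j h0 hh).sub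
      (tendsto_pi_nhds.1 (tendsto_pi_nhds.1 h2 j) j)
    refine h3.congr fun k => ?_
    rw [H.variance_diffResidual z s (h k) i j (hK i)]
    rfl
  refine le_measure_abs_le_inter_of_tendsto
    (V := fun k x => diffResidual G W K S z s (h k) x.1 x.2)
    (fun k x => (H.memLp_diffResidual z s (h k) x.1 x.2).aemeasurable) ?_ hA fun ε hε => ?_
  · filter_upwards [hdiff] with ω hω x
    have h1 := tendsto_slope_partialDeriv (hω x.1) x.2 h0 hh
    have h2 : Tendsto (fun k => ∑ a,
        (crossDiff (K x.1) z s (h k) * (noisyGram (K x.1) (S x.1 x.1) z)⁻¹) x.2 a *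
          observation G W z a x.1 ω) atTop (𝓝 (∑ a,
        (crossDeriv (K x.1) z s * (noisyGram (K x.1) (S x.1 x.1) z)⁻¹) x.2 a *
          observation G W z a x.1 ω)) :=
      tendsto_finsetSum _ fun a _ => (hcoef x.1 x.2 a).mul_const _
    rw [postDerivMean, mulVec_mulVec]
    exact h1.sub h2
  · -- The slack `ε` absorbs the difference between the variances and their limits.
    have hev : ∀ᶠ k in atTop, ∀ x : Fin n × (Fin n ⊕ Fin m),
        √q * √(Var[diffResidual G W K S z s (h k) x.1 x.2; P]) ≤
          √q * √(postDerivCov (K x.1) (S x.1 x.1) z s x.2 x.2) + ε :=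
      eventually_all.2 fun x => (hvar x.1 x.2).eventually_le_const (by linarith)
    filter_upwards [hev] with k hk
    have hmem (b : Fin n × (Fin n ⊕ Fin m) → ℝ) (ω) :
        (∀ x, |diffResidual G W K S z s (h k) x.1 x.2 ω| ≤ b x) ↔
        (fun x : Fin n × (Fin n ⊕ Fin m) => diffResidual G W K S z s (h k) x.1 x.2 ω) ∈
          ⋂ x, {y | |y x| ≤ b x} := by simp
    simp only [hmem]
    rw [hind (h k) _ (.iInter fun x => measurableSet_le (by fun_prop) (by fun_prop))]
    refine mul_le_mul_left ?_ _
    simp only [← hmem]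
    have hgauss := (H.hasGaussianLaw_diffResidual_observation z s (h k)).fst
    have hsidak := hgauss.prod_measure_abs_le_le
      (X := fun x : Fin n × (Fin n ⊕ Fin m) => diffResidual G W K S z s (h k) x.1 x.2)
      (fun x => H.integral_diffResidual z s (h k) x.1 x.2)
      (fun x => √q * √(postDerivCov (K x.1) (S x.1 x.1) z s x.2 x.2) + ε) Finset.univ
    simp only [Finset.mem_univ, true_imp_iff] at hsidak
    refine le_trans ?_ hsidak
    -- One factor for each of the `n * (n + m)` entries.
    calc ENNReal.ofReal p ^ n
        ≤ (gaussianReal 0 1 {x | |x| ≤ √q} ^ (n + m)) ^ n := by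
          gcongr
          exact ofReal_le_gaussianReal_abs_le_pow (n + m) hp1
      _ = ∏ _x : Fin n × (Fin n ⊕ Fin m), gaussianReal 0 1 {x | |x| ≤ √q} := by
          simp [← pow_mul, mul_comm]
      _ ≤ _ := Finset.prod_le_prod' fun x _ =>
          (hgauss.eval x).gaussianReal_abs_le_le (H.integral_diffResidual z s (h k) x.1 x.2) (hk x)

theorem isNoisyGP_of_indep [IsProbabilityMeasure P] (g : Ω → StateInput n m → Fin n → ℝ)
    {k : Fin n → StateInput n m → StateInput n m → ℝ}
    (hGP : ∀ i, IsZeroMeanGP (fun z ω => g ω z i) (k i) P)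
    (hindep : iIndepFun (fun i ω z => g ω z i) P)
    {S : Matrix (Fin n) (Fin n) ℝ} (hS : S.PosSemidef)
    (w : Fin N → Ω → EuclideanSpace ℝ (Fin n))
    (hwlaw : ∀ a, HasLaw (w a) (multivariateGaussian 0 S) P)
    (hwindep : iIndepFun w P) (hgw : IndepFun g (fun ω a => w a ω) P) :
    IsNoisyGP (fun i s ω => g ω s i) (fun a i ω => w a ω i) k S P := by
  have hwg (a) : HasGaussianLaw (w a) P := (hwlaw a).hasGaussianLaw
  have hwi (a i) : HasGaussianLaw (fun ω => w a ω i) P :=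
    (hwg a).map_fun (EuclideanSpace.proj i : EuclideanSpace ℝ (Fin n) →L[ℝ] ℝ)
  have hgi (i s) : HasGaussianLaw (fun ω => g ω s i) P := (hGP i).gaussian.hasGaussianLaw_eval s
  refine ⟨fun {T} _ τ => ?_, fun i s => (hGP i).mean s, fun a i => ?_, fun i i' s t => ?_,
    fun a b i i' => ?_, fun i s a i' => ?_⟩
  · have h1 (i) : HasGaussianLaw (fun ω t => g ω (τ t) i) P :=
      (((hGP i).gaussian.comp_right τ).hasGaussianLaw Finset.univ).map_fun
        (ContinuousLinearMap.pi fun t =>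
          ContinuousLinearMap.proj (R := ℝ) (φ := fun _ : (Finset.univ : Finset T) => ℝ)
            ⟨t, Finset.mem_univ t⟩)
    have h2 : HasGaussianLaw (fun ω i t => g ω (τ t) i) P := by
      refine iIndepFun.hasGaussianLaw h1 ?_
      exact hindep.comp (fun _ y t => y (τ t)) fun _ => by fun_prop
    have h3 : HasGaussianLaw (fun ω a i => w a ω i) P :=
      (iIndepFun.hasGaussianLaw hwg hwindep).map_fun (ContinuousLinearMap.pi fun a =>
        (EuclideanSpace.equiv (Fin n) ℝ).toContinuousLinearMap ∘L
          ContinuousLinearMap.proj (R := ℝ) (φ := fun _ : Fin N => EuclideanSpace ℝ (Fin n)) a)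
    refine IndepFun.hasGaussianLaw h2 h3 ?_
    exact hgw.comp (φ := fun y i t => y (τ t) i)
      (ψ := fun (y : Fin N → EuclideanSpace ℝ (Fin n)) a i => y a i) (by fun_prop) (by fun_prop)
  · have := (hwlaw a).integral_eq
    rw [integral_id_multivariateGaussian] at this
    have h2 := (EuclideanSpace.proj i : EuclideanSpace ℝ (Fin n) →L[ℝ] ℝ).integral_comp_comm
      (hwg a).integrable
    rw [this] at h2
    simpa using h2
  · split_ifs with hii
    · subst hii; exact (hGP i).cov s t
    · exact ((hindep.indepFun hii).comp (measurable_pi_apply s)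
        (measurable_pi_apply t)).covariance_eq_zero (hgi i s).memLp_two (hgi i' t).memLp_two
  · split_ifs with hab
    · subst hab
      rw [(hwlaw a).covariance_fun_comp (f := fun x => x i) (g := fun x => x i')
        (Measurable.aemeasurable (by fun_prop)) (Measurable.aemeasurable (by fun_prop)),
        covariance_eval_multivariateGaussian hS]
    · have : IndepFun (fun ω => w a ω i) (fun ω => w b ω i') P :=
        (hwindep.indepFun hab).comp (φ := fun x : EuclideanSpace ℝ (Fin n) => x i)
          (ψ := fun x : EuclideanSpace ℝ (Fin n) => x i') (by fun_prop) (by fun_prop)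
      exact this.covariance_eq_zero (hwi a i).memLp_two (hwi b i').memLp_two
  · have : IndepFun (fun ω => g ω s i) (fun ω => w a ω i') P :=
      hgw.comp (φ := fun y : StateInput n m → Fin n → ℝ => y s i)
        (ψ := fun y : Fin N → EuclideanSpace ℝ (Fin n) => y a i') (by fun_prop) (by fun_prop)
    exact this.covariance_eq_zero (hgi i s).memLp_two (hwi a i').memLp_two

theorem aemeasurable_partialDeriv {G : StateInput n m → Ω → ℝ} (hG : ∀ t, AEMeasurable (G t) P)
    (s : StateInput n m) (hd : ∀ᵐ ω ∂P, DifferentiableAt ℝ (fun t => G t ω) s)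
    (j : Fin n ⊕ Fin m) : AEMeasurable (fun ω => partialDeriv (fun t => G t ω) s j) P := by
  refine aemeasurable_of_tendsto_metrizable_ae' (f := fun (k : ℕ) ω =>
    (G (s + (1 / ((k : ℝ) + 1)) • Pi.single j 1) ω - G s ω) / (1 / ((k : ℝ) + 1)))
    (fun k => ((hG _).sub (hG _)).div_const _) ?_
  filter_upwards [hd] with ω hω
  exact tendsto_slope_partialDeriv hω j (fun k => by positivity)
    tendsto_one_div_add_atTop_nhds_zero_nat

end GPLin

end

theorem lemma2 {Ω : Type*} [mΩ : MeasurableSpace Ω] (P : Measure Ω) [IsProbabilityMeasure P]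
    {n m N : ℕ}
    -- the known part `f` and the unknown part `g`, both continuously differentiable
    (f : GPLin.StateInput n m → Fin n → ℝ) (hf : ContDiff ℝ 1 f)
    (g : Ω → GPLin.StateInput n m → Fin n → ℝ) (hg : Measurable g)
    (hgdiff : ∀ᵐ ω ∂P, ContDiff ℝ 1 (g ω))
    -- the components of `g` are drawn from independent zero-mean Gaussian processes, SE kernels
    (σ : Fin n → ℝ) (hσ : ∀ i, 0 < σ i ^ 2)
    (l : Fin n → Fin n ⊕ Fin m → ℝ) (hl : ∀ i j, 0 < l i j)
    (hGP : ∀ i, GPLin.IsZeroMeanGP (fun z ω => g ω z i) (GPLin.seKernel (σ i) (l i)) P)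
    (hindep : iIndepFun (fun i ω z => g ω z i) P)
    -- i.i.d. measurement noise with law `N(0, Sn)`, independent of `g`
    (Sn : Matrix (Fin n) (Fin n) ℝ) (hSn : Sn.PosSemidef)
    (w : Fin N → Ω → EuclideanSpace ℝ (Fin n)) (hw : ∀ a, Measurable (w a))
    (hwlaw : ∀ a, HasLaw (w a) (multivariateGaussian 0 Sn) P)
    (hwindep : iIndepFun w P)
    (hgw : IndepFun g (fun ω a => w a ω) P)
    -- the training inputs; the inverses in the posterior formulas exist
    (z : Fin N → GPLin.StateInput n m)
    (hK : ∀ i, IsUnit (GPLin.noisyGram (GPLin.seKernel (σ i) (l i)) (Sn i i) z).det)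
    -- the point of linearization and the level
    (ze : GPLin.StateInput n m) (p : ℝ) (hp0 : 0 ≤ p) (hp1 : p < 1) :
    -- the probability that the Jacobian lies in the box, for an arbitrary noise covariance
    p ^ n ≤ P.real {ω | GPLin.jacobian (GPLin.dynamics f g ω) ze ∈
      GPLin.uncertaintyBox f (fun i => GPLin.seKernel (σ i) (l i)) (fun i => Sn i i) z
        (GPLin.targets f g w z ω) ze p} ∧
    -- the conditional probability given the data, for noise with independent components
    (Sn.IsDiag → ∀ᵐ ω ∂P, p ^ n ≤
      (P⟦{ω' | GPLin.jacobian (GPLin.dynamics f g ω') ze ∈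
        GPLin.uncertaintyBox f (fun i => GPLin.seKernel (σ i) (l i)) (fun i => Sn i i) z
          (GPLin.targets f g w z ω') ze p} |
        MeasurableSpace.comap (GPLin.targets f g w z) inferInstance⟧) ω) := by
  have H := GPLin.isNoisyGP_of_indep g hGP hindep hSn w hwlaw hwindep hgw
  set G : Fin n → GPLin.StateInput n m → Ω → ℝ := fun i s ω => g ω s i
  set W : Fin N → Fin n → Ω → ℝ := fun a i ω => w a ω i
  have hdiff : ∀ᵐ ω ∂P, ∀ i, DifferentiableAt ℝ (fun t => G i t ω) ze := by
    filter_upwards [hgdiff] with ω hω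
    exact differentiableAt_pi.1 (hω.differentiable one_ne_zero ze)
  set E : Set Ω := {ω | GPLin.jacobian (GPLin.dynamics f g ω) ze ∈
      GPLin.uncertaintyBox f (fun i => GPLin.seKernel (σ i) (l i)) (fun i => Sn i i) z
        (GPLin.targets f g w z ω) ze p}
  set E' : Set Ω := {ω | ∀ x : Fin n × (Fin n ⊕ Fin m),
      |GPLin.partialDeriv (fun t => G x.1 t ω) ze x.2 -
        GPLin.postDerivMean (GPLin.seKernel (σ x.1) (l x.1)) (Sn x.1 x.1) z
          (fun a => GPLin.observation G W z a x.1 ω) ze x.2| ≤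
        √(GPLin.chiSquaredQuantile (n + m) p) * √(GPLin.postDerivCov
          (GPLin.seKernel (σ x.1) (l x.1)) (Sn x.1 x.1) z ze x.2 x.2)} with hE'
  have hEE' : E =ᵐ[P] E' := by
    refine Filter.eventuallyEq_set.2 ?_
    filter_upwards [hgdiff] with ω hω
    refine (GPLin.jacobian_mem_uncertaintyBox_iff hf hω _ _ z _ ze p).trans ?_
    simp only [GPLin.targets_apply]
    rfl
  have hpn : ENNReal.ofReal p ^ n = ENNReal.ofReal (p ^ n) := (ENNReal.ofReal_pow hp0 n).symm
  refine ⟨?_, fun hdiag => ?_⟩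
  · have key := H.ofReal_pow_mul_le z hK ze hdiff hp1 MeasurableSet.univ (fun h B _ => by simp)
    rw [measure_univ, mul_one, Set.inter_univ, hpn] at key
    rw [measureReal_congr hEE']
    exact (ENNReal.ofReal_le_iff_le_toReal (measure_ne_top _ _)).1 key
  · have hobs (a i) : AEMeasurable (GPLin.observation G W z a i) P :=
      (H.memLp_observation z a i).aemeasurable
    have hE'm : NullMeasurableSet E' P := by
      simp only [hE', Set.ofPred_forall]
      refine .iInter fun x => nullMeasurableSet_le (AEMeasurable.abs (AEMeasurable.sub
        (GPLin.aemeasurable_partialDeriv (fun t => (H.memLp_fun x.1 t).aemeasurable) ze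
          (hdiff.mono fun ω hω => hω x.1) x.2) ?_)) aemeasurable_const
      simp only [GPLin.postDerivMean, mulVec, dotProduct]
      exact Finset.aemeasurable_fun_sum _ fun a _ => AEMeasurable.const_mul
        (Finset.aemeasurable_fun_sum _ fun b _ => (hobs b x.1).const_mul _) _
    have htm : Measurable (GPLin.targets f g w z) := by
      refine measurable_pi_iff.2 fun a => measurable_pi_iff.2 fun i => ?_
      simp only [GPLin.targets_apply, GPLin.observation]
      have := hw a
      fun_prop
    refine ae_le_condExp_indicator htm.comap_le (hE'm.congr hEE'.symm) fun A hA => ?_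
    obtain ⟨B, hB, rfl⟩ := hA
    have key := H.ofReal_pow_mul_le z hK ze hdiff hp1 (htm hB) fun h C hC => by
      have ht : GPLin.targets f g w z ⁻¹' B = (fun ω (x : Fin N × Fin n) =>
          GPLin.observation G W z x.1 x.2 ω) ⁻¹'
            {y : Fin N × Fin n → ℝ | (fun a i => y (a, i)) ∈ B} := by
        ext ω
        have : GPLin.targets f g w z ω = fun a i => GPLin.observation G W z a i ω := by
          ext a i
          exact GPLin.targets_apply f g w z ω a i
        simp [this]
      rw [ht]
      exact (H.indepFun_diffResidual_observation z ze h hdiag hK).measure_inter_preimage_eq_mul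
        _ _ hC (hB.preimage (by fun_prop))
    have hcongr : P (E ∩ GPLin.targets f g w z ⁻¹' B) = P (E' ∩ GPLin.targets f g w z ⁻¹' B) :=
      measure_congr (hEE'.inter (ae_eq_refl _))
    rw [Measure.real, Measure.real, hcongr]
    have h2 := ENNReal.toReal_mono (measure_ne_top _ _) key
    rwa [ENNReal.toReal_mul, hpn, ENNReal.toReal_ofReal (pow_nonneg hp0 n)] at h2
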